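/- Let $C:\mathbb{R}\to\mathbb{R}^+$ be of class $C^2$ with $C(s)\ge\delta>\varepsilon^2$ ($\delta,\varepsilon>0$ constants) and $C''(s)>-\tfrac1{24}$ for all $s$. Put $f(p,q,y)=q^2-3p^2+\tfrac{py}{2}-\tfrac{y^2}{48}$ and $$\Omega=\{(p,q)\in\mathbb{R}^2 : \varepsilon\le q\le h(p)\},$$ where $q=h(p)$, $p\in\mathbb R$, is the envelope in the half-plane $q>0$ of the family of hyperbolas $f(p,q,s)=C(s)$, $s\in\mathbb{R}$, that is, the set of all $(p,q)$, $q>0$, such that $f(p,q,s)=C(s)$ and $\partial_s f(p,q,s)=C'(s)$ for some $s$; it consists of the points $(p_0(s),q_0(s))=\bigl(2C'(s)+\tfrac{s}{12},\sqrt{C(s)+12C'(s)^2}\bigr)$. Let $g:\mathbb{R}\to\mathbb{R}^+$ be of class $C^\infty$ with $g(s)<A=\mathrm{const}$, and let $d\mu(p,q)=\tilde g(p,q)\,dp\,dq$ on $\Omega$, where $\tilde g$ is positive and $C^\infty$ on $\Omega$, $\tilde g(p_0(s),q_0(s))=g(s)$ for all $s$, and $\iint_\Omega e^{a(q+|p|)}\,d\mu(p,q)<\infty$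 for every $a>0$. Then, for all real $x,z,y$ and all $t>0$, the integral $$F(x,z,y,t)=\iint_\Omega\exp[ip(x-z)-q(x+z)+2qf(p,q,y)t]\,d\mu(p,q)$$ converges absolutely; $F$ is $C^\infty$ on $\{t>0\}$ and satisfies, with $\alpha=i$, the system $$F_t+\tfrac{y^2}{48\alpha^2}(F_x+F_z)+\tfrac{y}{4\alpha}(F_{xx}-F_{zz})+F_{xxx}+F_{zzz}=0,\qquad \alpha F_y+\tfrac{yt}{24\alpha}(F_x+F_z)+\tfrac t4(F_{xx}-F_{zz})=0;$$ for all $x,y\in\mathbb{R}$ and $t>0$ the Marchenko equation $$K(x,z,y,t)+F(x,z,y,t)+\int_x^\infty K(x,\xi,y,t)F(\xi,z,y,t)\,d\xi=0\qquad(z\ge x)$$ has a unique solution $K(x,\cdot,y,t)$ in $L^2[x,\infty)$ (taken to satisfy the equation at every $z\ge x$); the function $x\mapsto K(x,x,y,t)$ is differentiable, and $$v(x,y,t)=2\,\partial_x K(x,x,y,t)$$ is a real-valued $C^\infty$ function on $\{(x,y,t): t>0\}$ satisfying the Johnson equation JE-I $$\Bigl(v_t+\tfrac14v_{xxx}+\tfrac32vv_x+\tfrac{v}{2t}\Bigr)_x=\tfrac{12}{t^2}v_{yy}.$$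 Moreover $v(x,y,t)\to0$ as $x\to+\infty$ for all fixed $y$ and $t>0$, and for every $x_0\in\mathbb{R}$ and every compact $Q\subset\mathbb{R}\times(0,\infty)$, $v$ is bounded on $\{(x,y,t): x\ge x_0,\ (y,t)\in Q\}$. -/

import Mathlib

open MeasureTheory Filter Topology Set
open scoped ContDiff ENNReal

namespace Johnson

noncomputable section

/-- The phase function `f(p,q,y) = q² - 3p² + py/2 - y²/48`. -/
def phase (p q y : ℝ) : ℝ := q ^ 2 - 3 * p ^ 2 + p * y / 2 - y ^ 2 / 48

/-- First coordinate of the point where the hyperbola `f(p,q,s) = C(s)` touches the envelope. -/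
def p₀ (C : ℝ → ℝ) (s : ℝ) : ℝ := 2 * deriv C s + s / 12

/-- Second coordinate of the point where the hyperbola `f(p,q,s) = C(s)` touches the envelope. -/
def q₀ (C : ℝ → ℝ) (s : ℝ) : ℝ := Real.sqrt (C s + 12 * (deriv C s) ^ 2)

/-- The envelope, in the half-plane `q > 0`, of the one-parameter family of hyperbolas
`f(p,q,s) = C(s)`, `s ∈ ℝ`: the points satisfying, for some value of the parameter `s`, both the
equation of the family and its derivative with respect to `s`. -/
def envelope (C : ℝ → ℝ) : Set (ℝ × ℝ) :=
  {w | 0 < w.2 ∧ ∃ s : ℝ, phase w.1 w.2 s = C s ∧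
    deriv (fun r => phase w.1 w.2 r - C r) s = 0}

/-- The envelope consists exactly of the points `(p₀(s), q₀(s))`. -/
theorem envelope_eq_range {C : ℝ → ℝ} (hC : Differentiable ℝ C) (hpos : ∀ s, 0 < C s) :
    envelope C = Set.range (fun s => (p₀ C s, q₀ C s)) := by
  have hd : ∀ p q s : ℝ, deriv (fun r => phase p q r - C r) s = p / 2 - s / 24 - deriv C s := by
    intro p q s
    have h1 : HasDerivAt (fun r : ℝ => phase p q r) (p / 2 - s / 24) s := by
      have h2 := ((((hasDerivAt_id' s).const_mul p).div_const 2).const_add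
        (q ^ 2 - 3 * p ^ 2)).sub ((hasDerivAt_pow 2 s).div_const 48)
      refine h2.congr_deriv ?_
      norm_num
      ring
    exact (h1.sub (hC s).hasDerivAt).deriv
  ext ⟨p, q⟩
  simp only [envelope, mem_ofPred_eq, mem_range, Prod.mk.injEq, hd]
  constructor
  · rintro ⟨hq, s, h1, h2⟩
    have hp : p = 2 * deriv C s + s / 12 := by linarith
    refine ⟨s, hp.symm, ?_⟩
    unfold q₀
    rw [Real.sqrt_eq_iff_mul_self_eq (by have := hpos s; positivity) hq.le]
    unfold phase at h1
    rw [hp] at h1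
    nlinarith
  · rintro ⟨s, rfl, rfl⟩
    have hs : 0 < C s + 12 * (deriv C s) ^ 2 := by have := hpos s; positivity
    refine ⟨Real.sqrt_pos.2 hs, s, ?_, ?_⟩
    · unfold phase q₀ p₀
      rw [Real.sq_sqrt hs.le]
      ring
    · unfold p₀
      ring

/-- Condition A on the function `C`. -/
structure ConditionA (C : ℝ → ℝ) (δ ε : ℝ) : Prop where
  contDiff : ContDiff ℝ 2 C
  eps_pos : 0 < ε
  eps_lt : ε ^ 2 < δ
  le : ∀ s, δ ≤ C s
  second_deriv : ∀ s, -1 / 24 < deriv (deriv C) s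

/-- Condition B, first part: the curve `q = h(p)`, `p ∈ ℝ`, is the envelope of the hyperbolas
`f(p,q,s) = C(s)`. -/
def ConditionB (C h : ℝ → ℝ) : Prop := envelope C = {w : ℝ × ℝ | w.2 = h w.1}

/-- Condition B, second part: the set `Ω = {(p,q) : ε ≤ q ≤ h(p)}`. -/
def region (ε : ℝ) (h : ℝ → ℝ) : Set (ℝ × ℝ) := {w | ε ≤ w.2 ∧ w.2 ≤ h w.1}

/-- The measure `dμ = g̃(p,q) dp dq` on `Ω`. -/
def spectralMeasure (Ω : Set (ℝ × ℝ)) (gt : ℝ × ℝ → ℝ) : Measure (ℝ × ℝ) :=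
  (volume.restrict Ω).withDensity (fun w => ENNReal.ofReal (gt w))

/-- Condition C on the function `g` and the density `g̃`. -/
structure ConditionC (C g : ℝ → ℝ) (A : ℝ) (Ω : Set (ℝ × ℝ)) (gt : ℝ × ℝ → ℝ) : Prop where
  g_pos : ∀ s, 0 < g s
  g_lt : ∀ s, g s < A
  g_smooth : ContDiff ℝ ∞ g
  gt_pos : ∀ w ∈ Ω, 0 < gt w
  gt_smooth : ContDiffOn ℝ ∞ gt Ω
  gt_eq : ∀ s, gt (p₀ C s, q₀ C s) = g s
  exp_moment : ∀ a : ℝ, 0 < a →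
    ∫⁻ w, ENNReal.ofReal (Real.exp (a * (w.2 + |w.1|))) ∂(spectralMeasure Ω gt) < ⊤

/-- The integrand `exp[ip(x-z) - q(x+z) + 2q f(p,q,y) t]`, with `w = (p,q)`. -/
def kernelIntegrand (x z y t : ℝ) (w : ℝ × ℝ) : ℂ :=
  Complex.exp (Complex.I * ((w.1 * (x - z) : ℝ) : ℂ)
    + ((-w.2 * (x + z) + 2 * w.2 * phase w.1 w.2 y * t : ℝ) : ℂ))

/-- The kernel `F(x,z,y,t) = ∬ exp[ip(x-z) - q(x+z) + 2q f(p,q,y) t] dμ(p,q)`. -/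
def kernel (μ : Measure (ℝ × ℝ)) (x z y t : ℝ) : ℂ := ∫ w, kernelIntegrand x z y t w ∂μ

/-- The system of linear differential equations for the kernel `F`, for `t > 0`:
`F_t + y²/(48α²) (F_x + F_z) + y/(4α) (F_xx - F_zz) + F_xxx + F_zzz = 0` and
`α F_y + yt/(24α) (F_x + F_z) + t/4 (F_xx - F_zz) = 0`. -/
def SolvesLinearSystem (α : ℂ) (F : ℝ → ℝ → ℝ → ℝ → ℂ) : Prop :=
  ∀ x z y t : ℝ, 0 < t →
    (deriv (fun t' => F x z y t') t
      + (y : ℂ) ^ 2 / (48 * α ^ 2) *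
          (deriv (fun x' => F x' z y t) x + deriv (fun z' => F x z' y t) z)
      + (y : ℂ) / (4 * α) *
          (iteratedDeriv 2 (fun x' => F x' z y t) x - iteratedDeriv 2 (fun z' => F x z' y t) z)
      + iteratedDeriv 3 (fun x' => F x' z y t) x
      + iteratedDeriv 3 (fun z' => F x z' y t) z = 0) ∧
    (α * deriv (fun y' => F x z y' t) y
      + (y : ℂ) * t / (24 * α) *
          (deriv (fun x' => F x' z y t) x + deriv (fun z' => F x z' y t) z)
      + (t : ℂ) / 4 *
          (iteratedDeriv 2 (fun x' => F x' z y t) x - iteratedDeriv 2 (fun z' => F x z' y t) z)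
      = 0)

/-- The function `φ` satisfies the Marchenko equation with parameters `x, y, t` at the point `z`:
`φ(z) + F(x,z,y,t) + ∫_x^∞ φ(ξ) F(ξ,z,y,t) dξ = 0`, with absolutely convergent integral. -/
def MarchenkoAt (F : ℝ → ℝ → ℝ → ℝ → ℂ) (x y t : ℝ) (φ : ℝ → ℂ) (z : ℝ) : Prop :=
  IntegrableOn (fun ξ => φ ξ * F ξ z y t) (Ioi x) ∧
    φ z + F x z y t + ∫ ξ in Ioi x, φ ξ * F ξ z y t = 0

/-- The Johnson equation
`(v_t + v_xxx/4 + (3/2) v v_x + v/(2t))_x = -(12σ/t²) v_yy` for `t > 0`, where `σ = α² = ±1`.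
JE-I is the case `σ = -1`. -/
def SolvesJohnson (σ : ℝ) (v : ℝ → ℝ → ℝ → ℝ) : Prop :=
  ∀ x y t : ℝ, 0 < t →
    deriv (fun x' => deriv (fun t' => v x' y t') t
        + 1 / 4 * iteratedDeriv 3 (fun x'' => v x'' y t) x'
        + 3 / 2 * v x' y t * deriv (fun x'' => v x'' y t) x'
        + v x' y t / (2 * t)) x
      = -(12 * σ / t ^ 2) * iteratedDeriv 2 (fun y' => v x y' t) y

end

end Johnson

/-!
The variables `X = x + y² t / 48`, `Y = y t`, `T = t` turn the Johnson equation JE-I into the KP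
equation with constant coefficients, and the kernel into `F = ⟨u(Z, Y, T), u(X, Y, T)⟩` in `L²(μ)`,
where `u = exp (a X + (i/4) a² Y - a³ T)` and `a = i p - q`. On the region, `phase p q y ≤ C y`
for every `y`, because `C(r) + r²/48` is convex and the region lies below the envelope
(`phase_le_of_mem_region`). Together with the exponential moments this makes `aⁿ u` a smooth
function of `(X, Y, T)`, `T > 0`, with values in `L²(μ)`; since `q ≥ ε` it decays like
`exp (-ε X)`. These are the only properties used (`IsFlow`).

The Marchenko equation is thereby moved from `L²[x, ∞)`, which depends on `x`, to the fixed space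
`L²(μ)`: with the positive Gram operator `G = ∫_X^∞ u ⊗ u* dX'`, its unique solution is
`K(x, z) = -⟨u(Z), (1 + G)⁻¹ u(X)⟩` (`IsFlow.marchenkoAt_marchenkoKernel`,
`IsFlow.marchenko_unique`).

All derivatives of `G` have finite rank: `∂_X G = -u ⊗ u*`, and likewise in `Y` and `T`
(`IsFlow.hasFDerivAt_gram`). So the matrix elements `S m n = ⟨aᵐ u, (1 + G)⁻¹ aⁿ u⟩` are smooth and
their partial derivatives are polynomials in the `S m n` (`IsFlow.hasFDerivAt_elt`). The three
derivations so defined on formal polynomials commute, and the KP equation for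
`v = 2 ∂_X K = -2 ∂_X S 0 0` is a polynomial identity (`kp`). Decay and boundedness of `v` follow
from `|S m n| ≤ ‖aᵐ u‖ ‖aⁿ u‖`.
-/

namespace Johnson

noncomputable section

/-! ### The KP equation as a polynomial identity -/

/-- Polynomials in formal variables `S m n`, which stand for the matrix elements
`⟨V m, (1 + G)⁻¹ V n⟩` of a resolvent (`elt` below). -/
abbrev JetRing : Type := MvPolynomial (ℕ × ℕ) ℂ

/-- The formal variable `S m n`. -/
def jet (m n : ℕ) : JetRing := MvPolynomial.X (m, n)

/-- The derivation of `JetRing` by which `∂_X` acts on the functions `S m n`. -/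
def dX : Derivation ℂ JetRing JetRing :=
  MvPolynomial.mkDerivation ℂ fun i =>
    jet (i.1 + 1) i.2 + jet i.1 (i.2 + 1) + jet i.1 0 * jet 0 i.2

/-- The derivation of `JetRing` by which `-4i ∂_Y` acts on the functions `S m n`. -/
def dY' : Derivation ℂ JetRing JetRing :=
  MvPolynomial.mkDerivation ℂ fun i =>
    jet i.1 (i.2 + 2) - jet (i.1 + 2) i.2 + jet i.1 1 * jet 0 i.2 - jet i.1 0 * jet 1 i.2

/-- The derivation of `JetRing` by which `∂_Y` acts on the functions `S m n`. -/
def dY : Derivation ℂ JetRing JetRing := (Complex.I / 4) • dY'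

/-- The derivation of `JetRing` by which `∂_T` acts on the functions `S m n`. -/
def dT : Derivation ℂ JetRing JetRing :=
  MvPolynomial.mkDerivation ℂ fun i =>
    -(jet (i.1 + 3) i.2 + jet i.1 (i.2 + 3)
      + jet i.1 2 * jet 0 i.2 - jet i.1 1 * jet 1 i.2 + jet i.1 0 * jet 2 i.2)

theorem dX_jet (m n : ℕ) :
    dX (jet m n) = jet (m + 1) n + jet m (n + 1) + jet m 0 * jet 0 n :=
  MvPolynomial.mkDerivation_X ..

theorem dY'_jet (m n : ℕ) :
    dY' (jet m n) = jet m (n + 2) - jet (m + 2) n + jet m 1 * jet 0 n - jet m 0 * jet 1 n :=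
  MvPolynomial.mkDerivation_X ..

theorem dY_apply (P : JetRing) : dY P = (Complex.I / 4) • dY' P := rfl

theorem dT_jet (m n : ℕ) :
    dT (jet m n) = -(jet (m + 3) n + jet m (n + 3)
      + jet m 2 * jet 0 n - jet m 1 * jet 1 n + jet m 0 * jet 2 n) :=
  MvPolynomial.mkDerivation_X ..

theorem dX_dY_comm (P : JetRing) : dX (dY P) = dY (dX P) := by
  have h : ⁅dX, dY'⁆ = 0 := by
    refine MvPolynomial.derivation_ext fun ⟨m, n⟩ => ?_
    change ⁅dX, dY'⁆ (jet m n) = 0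
    simp only [Derivation.commutator_apply, dX_jet, dY'_jet, Derivation.leibniz, map_add, map_sub,
      smul_eq_mul]
    ring
  have h2 := congrArg (fun D : Derivation ℂ JetRing JetRing => D P) h
  have h3 : dX (dY' P) = dY' (dX P) :=
    sub_eq_zero.1 (by simpa [Derivation.commutator_apply] using h2)
  rw [dY_apply, dY_apply, Derivation.map_smul, h3]

theorem dX_dT_comm (P : JetRing) : dX (dT P) = dT (dX P) := by
  have h : ⁅dX, dT⁆ = 0 := by
    refine MvPolynomial.derivation_ext fun ⟨m, n⟩ => ?_
    change ⁅dX, dT⁆ (jet m n) = 0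
    simp only [Derivation.commutator_apply, dX_jet, dT_jet, Derivation.leibniz, map_add, map_sub,
      map_neg, smul_eq_mul]
    ring
  have h2 := congrArg (fun D : Derivation ℂ JetRing JetRing => D P) h
  exact sub_eq_zero.1 (by simpa [Derivation.commutator_apply] using h2)

/-- The potential form of KP for `K = -S 0 0`. It is a polynomial identity in the free variables
`S m n`; evaluating polynomials at points reduces it to one between complex numbers. -/
theorem potential_kp :
    dX (dT (jet 0 0) + (1 / 4 : ℂ) • dX (dX (dX (jet 0 0))) - (3 / 2 : ℂ) • dX (jet 0 0) ^ 2)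
      = (12 : ℂ) • dY (dY (jet 0 0)) := by
  have hY : dY (dY (jet 0 0)) = (-1 / 16 : ℂ) • dY' (dY' (jet 0 0)) := by
    rw [dY_apply, dY_apply, Derivation.map_smul, smul_smul]
    congr 1
    linear_combination (1 / 16) * Complex.I_sq
  rw [hY]
  simp only [dX_jet, dY'_jet, dT_jet, Derivation.leibniz, map_add, map_sub, map_neg,
    Derivation.map_smul, pow_two, smul_eq_mul, Nat.reduceAdd, zero_add]
  refine MvPolynomial.funext fun x => ?_
  simp only [map_add, map_sub, map_neg, map_mul, MvPolynomial.smul_eval]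
  ring

/-- The polynomial that represents `v = 2 ∂_X K`, where `K = - S 0 0`. -/
def solutionJet : JetRing := (-2 : ℂ) • dX (jet 0 0)

/-- The KP equation for `v = 2 ∂_X K`: the `X`-derivative of its potential form. -/
theorem kp :
    dX (dT solutionJet + (1 / 4 : ℂ) • dX (dX (dX solutionJet))
      + (3 / 2 : ℂ) • (solutionJet * dX solutionJet)) = (12 : ℂ) • dY (dY solutionJet) := by
  have h := congrArg (fun P => (-2 : ℂ) • dX P) potential_kp
  simp only [Derivation.map_smul, map_add, map_sub, dX_dY_comm, dX_dT_comm] at h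
  unfold solutionJet
  simp only [Derivation.map_smul, map_add, dX_dT_comm, pow_two, Derivation.leibniz,
    smul_eq_mul] at h ⊢
  refine MvPolynomial.funext fun x => ?_
  have h2 := congrArg (MvPolynomial.eval x) h
  simp only [map_add, map_sub, map_mul, MvPolynomial.smul_eval] at h2 ⊢
  linear_combination h2

/-! ### Linear maps on `ℝ³` and exponential flows in a Hilbert space -/

section Lin3

variable {E : Type*} [NormedAddCommGroup E] [NormedSpace ℝ E]

/-- The linear map on `ℝ³` with partial derivatives `A`, `B`, `C`. -/
def lin3 (A B C : E) : ℝ × ℝ × ℝ →L[ℝ] E :=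
  (ContinuousLinearMap.fst ℝ ℝ (ℝ × ℝ)).smulRight A
    + ((ContinuousLinearMap.fst ℝ ℝ ℝ).comp (ContinuousLinearMap.snd ℝ ℝ (ℝ × ℝ))).smulRight B
    + ((ContinuousLinearMap.snd ℝ ℝ ℝ).comp (ContinuousLinearMap.snd ℝ ℝ (ℝ × ℝ))).smulRight C

theorem lin3_apply (A B C : E) (η : ℝ × ℝ × ℝ) :
    lin3 A B C η = η.1 • A + η.2.1 • B + η.2.2 • C := rfl

theorem norm_lin3_le (A B C : E) : ‖lin3 A B C‖ ≤ ‖A‖ + ‖B‖ + ‖C‖ := by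
  refine ContinuousLinearMap.opNorm_le_bound _ (by positivity) fun η => ?_
  have h1 : ‖η.1‖ ≤ ‖η‖ := norm_fst_le η
  have h2 : ‖η.2‖ ≤ ‖η‖ := norm_snd_le η
  have h3 : ‖η.2.1‖ ≤ ‖η‖ := (norm_fst_le η.2).trans h2
  have h4 : ‖η.2.2‖ ≤ ‖η‖ := (norm_snd_le η.2).trans h2
  rw [lin3_apply]
  refine (norm_add₃_le).trans ?_
  rw [norm_smul, norm_smul, norm_smul, add_mul, add_mul, mul_comm ‖A‖, mul_comm ‖B‖, mul_comm ‖C‖]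
  gcongr

theorem lin3_ext {L : ℝ × ℝ × ℝ →L[ℝ] E} {A B C : E} (h1 : L (1, 0, 0) = A)
    (h2 : L (0, 1, 0) = B) (h3 : L (0, 0, 1) = C) : L = lin3 A B C := by
  refine ContinuousLinearMap.ext fun η => ?_
  have : η = η.1 • (1, 0, 0) + η.2.1 • (0, 1, 0) + η.2.2 • (0, 0, 1) := by
    ext <;> simp
  conv_lhs => rw [this]
  rw [map_add, map_add, map_smul, map_smul, map_smul, h1, h2, h3, lin3_apply]

@[simp] theorem lin3_apply_fst (A B C : E) : lin3 A B C (1, 0, 0) = A := by simp [lin3_apply]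

@[simp] theorem lin3_apply_snd (A B C : E) : lin3 A B C (0, 1, 0) = B := by simp [lin3_apply]

@[simp] theorem lin3_apply_trd (A B C : E) : lin3 A B C (0, 0, 1) = C := by simp [lin3_apply]

theorem contDiffOn_lin3 {A B C : ℝ × ℝ × ℝ → E} {k : WithTop ℕ∞} {s : Set (ℝ × ℝ × ℝ)}
    (hA : ContDiffOn ℝ k A s) (hB : ContDiffOn ℝ k B s) (hC : ContDiffOn ℝ k C s) :
    ContDiffOn ℝ k (fun θ => lin3 (A θ) (B θ) (C θ)) s :=
  ((contDiffOn_const.smulRight hA).add (contDiffOn_const.smulRight hB)).add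
    (contDiffOn_const.smulRight hC)

end Lin3

/-- The half-space `T > 0`. -/
def upper : Set (ℝ × ℝ × ℝ) := {θ | 0 < θ.2.2}

theorem isOpen_upper : IsOpen upper := isOpen_lt continuous_const (by fun_prop)

/-- The induction step for smoothness of a family of functions on `upper` that is closed under
differentiation. -/
theorem contDiffOn_succ_of_hasFDerivAt_upper {E : Type*} [NormedAddCommGroup E] [NormedSpace ℝ E]
    {f : ℝ × ℝ × ℝ → E} {f' : ℝ × ℝ × ℝ → ℝ × ℝ × ℝ →L[ℝ] E} {k : ℕ}
    (h : ∀ θ ∈ upper, HasFDerivAt f (f' θ) θ) (h' : ContDiffOn ℝ k f' upper) :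
    ContDiffOn ℝ (k + 1 : ℕ) f upper := by
  rw [Nat.cast_add, Nat.cast_one, contDiffOn_succ_iff_fderiv_of_isOpen isOpen_upper]
  refine ⟨fun θ hθ => (h θ hθ).differentiableAt.differentiableWithinAt, by simp, ?_⟩
  exact h'.congr fun θ hθ => (h θ hθ).fderiv

section Flow

variable {H : Type*} [NormedAddCommGroup H] [InnerProductSpace ℂ H]

/-- A family of vectors `V n (X, Y, T)`, `T > 0`, in a Hilbert space that behaves like
`aⁿ exp (a X + (i/4) a² Y - a³ T)` for an unbounded operator `a` with `Re a ≤ -ε`: applying `a`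
raises the index, and translation in `X` contracts exponentially. Indexing by `n` avoids any
unbounded operator. -/
structure IsFlow (V : ℕ → ℝ × ℝ × ℝ → H) (ε : ℝ) : Prop where
  eps_pos : 0 < ε
  hasFDerivAt : ∀ n, ∀ θ ∈ upper, HasFDerivAt (V n)
    (lin3 (V (n + 1) θ) ((Complex.I / 4) • V (n + 2) θ) (-V (n + 3) θ)) θ
  norm_shift_le : ∀ n, ∀ θ ∈ upper, ∀ s : ℝ, 0 ≤ s →
    ‖V n (θ + (s, 0, 0))‖ ≤ Real.exp (-(ε * s)) * ‖V n θ‖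

/-- The rank-one operator `V m ⊗ (V n)*`. -/
def dyad (V : ℕ → ℝ × ℝ × ℝ → H) (m n : ℕ) (θ : ℝ × ℝ × ℝ) : H →L[ℂ] H :=
  InnerProductSpace.rankOne ℂ (V m θ) (V n θ)

theorem dyad_apply (V : ℕ → ℝ × ℝ × ℝ → H) (m n : ℕ) (θ : ℝ × ℝ × ℝ) (ψ : H) :
    dyad V m n θ ψ = inner ℂ (V n θ) ψ • V m θ := rfl

theorem norm_dyad (V : ℕ → ℝ × ℝ × ℝ → H) (m n : ℕ) (θ : ℝ × ℝ × ℝ) :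
    ‖dyad V m n θ‖ = ‖V m θ‖ * ‖V n θ‖ := InnerProductSpace.norm_rankOne ..

/-- `(x, y) ↦ x ⊗ y*` is conjugate-linear in `y`, hence bilinear over `ℝ` only. -/
theorem isBoundedBilinearMap_rankOne : IsBoundedBilinearMap ℝ
    (fun p : H × H => InnerProductSpace.rankOne ℂ p.1 p.2) where
  add_left x₁ x₂ y := by rw [map_add, add_apply]
  smul_left c x y := by
    ext z
    simp only [InnerProductSpace.rankOne_apply, smul_apply]
    rw [smul_comm]
  add_right x y₁ y₂ := map_add _ _ _
  smul_right c x y := by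
    ext z
    simp only [InnerProductSpace.rankOne_apply, smul_apply]
    rw [← Complex.coe_smul, inner_smul_left, Complex.conj_ofReal, mul_smul, Complex.coe_smul]
  bound := ⟨1, one_pos, fun x y => by rw [InnerProductSpace.norm_rankOne, one_mul]⟩

namespace IsFlow

variable {V : ℕ → ℝ × ℝ × ℝ → H} {ε : ℝ}

theorem contDiffOn (hV : IsFlow V ε) (n : ℕ) : ContDiffOn ℝ ∞ (V n) upper := by
  rw [contDiffOn_infty]
  intro k
  induction k generalizing n with
  | zero =>
    exact contDiffOn_zero.2 fun θ hθ => (hV.hasFDerivAt n θ hθ).continuousAt.continuousWithinAt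
  | succ k ih =>
    exact contDiffOn_succ_of_hasFDerivAt_upper (hV.hasFDerivAt n)
      (contDiffOn_lin3 (ih _) ((ih _).const_smul _) (ih _).neg)

theorem contDiffOn_dyad (hV : IsFlow V ε) (m n : ℕ) : ContDiffOn ℝ ∞ (dyad V m n) upper :=
  (isBoundedBilinearMap_rankOne (H := H)).contDiff.comp_contDiffOn
    ((hV.contDiffOn m).prodMk (hV.contDiffOn n))

theorem hasFDerivAt_dyad (hV : IsFlow V ε) (m n : ℕ) {θ : ℝ × ℝ × ℝ} (hθ : θ ∈ upper) :
    HasFDerivAt (dyad V m n)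
      (lin3 (dyad V (m + 1) n θ + dyad V m (n + 1) θ)
        ((Complex.I / 4) • (dyad V (m + 2) n θ - dyad V m (n + 2) θ))
        (-(dyad V (m + 3) n θ + dyad V m (n + 3) θ))) θ := by
  refine ((isBoundedBilinearMap_rankOne.hasFDerivAt (V m θ, V n θ)).comp θ
    ((hV.hasFDerivAt m θ hθ).prodMk (hV.hasFDerivAt n θ hθ))).congr_fderiv ?_
  refine lin3_ext ?_ ?_ ?_ <;> ext z <;>
    simp only [ContinuousLinearMap.comp_apply, ContinuousLinearMap.prod_apply, lin3_apply_fst,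
      lin3_apply_snd, lin3_apply_trd, IsBoundedBilinearMap.deriv_apply, dyad_apply,
      add_apply, sub_apply, neg_apply,
      smul_apply, InnerProductSpace.rankOne_apply, inner_smul_left,
      inner_neg_left, map_div₀, Complex.conj_I, map_ofNat]
  · module
  · module
  · module

end IsFlow
end Flow

/-! ### The Gram operator and its resolvent -/

theorem integrableOn_Ioi_of_norm_le_exp {E : Type*} [NormedAddCommGroup E] {f : ℝ → E}
    {b c : ℝ} (hf : Continuous f) (hb : 0 < b)
    (h : ∀ s, 0 ≤ s → ‖f s‖ ≤ Real.exp (-(b * s)) * c) : IntegrableOn f (Ioi 0) := by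
  refine ((exp_neg_integrableOn_Ioi 0 hb).mul_const c).mono' hf.aestronglyMeasurable ?_
  filter_upwards [ae_restrict_mem measurableSet_Ioi] with s hs
  simpa [neg_mul] using h s (le_of_lt hs)

theorem lin3_zero {E : Type*} [NormedAddCommGroup E] [NormedSpace ℝ E] :
    lin3 (0 : E) 0 0 = 0 :=
  ContinuousLinearMap.ext fun η => by simp [lin3_apply]

theorem tendsto_lin3 {E α : Type*} [NormedAddCommGroup E] [NormedSpace ℝ E] {l : Filter α}
    {A B C : α → E} {a b c : E} (hA : Tendsto A l (𝓝 a)) (hB : Tendsto B l (𝓝 b))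
    (hC : Tendsto C l (𝓝 c)) :
    Tendsto (fun s => lin3 (A s) (B s) (C s)) l (𝓝 (lin3 a b c)) := by
  have key : ∀ (ℓ : ℝ × ℝ × ℝ →L[ℝ] ℝ) {f : α → E} {e : E}, Tendsto f l (𝓝 e) →
      Tendsto (fun s => ℓ.smulRight (f s)) l (𝓝 (ℓ.smulRight e)) := fun ℓ f e hf =>
    ((ContinuousLinearMap.smulRightL ℝ (ℝ × ℝ × ℝ) E ℓ).continuous.tendsto e).comp hf
  exact ((key _ hA).add (key _ hB)).add (key _ hC)

theorem continuous_lin3 {E : Type*} [NormedAddCommGroup E] [NormedSpace ℝ E] {A B C : ℝ → E}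
    (hA : Continuous A) (hB : Continuous B) (hC : Continuous C) :
    Continuous fun s => lin3 (A s) (B s) (C s) :=
  continuous_iff_continuousAt.2 fun _ => tendsto_lin3 hA.continuousAt hB.continuousAt
    hC.continuousAt

theorem hasDerivAt_lin3 {E : Type*} [NormedAddCommGroup E] [NormedSpace ℝ E] {A B C : ℝ → E}
    {A' B' C' : E} {s : ℝ} (hA : HasDerivAt A A' s) (hB : HasDerivAt B B' s)
    (hC : HasDerivAt C C' s) :
    HasDerivAt (fun s => lin3 (A s) (B s) (C s)) (lin3 A' B' C') s := by
  have key : ∀ (ℓ : ℝ × ℝ × ℝ →L[ℝ] ℝ) {f : ℝ → E} {f' : E}, HasDerivAt f f' s →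
      HasDerivAt (fun s => ℓ.smulRight (f s)) (ℓ.smulRight f') s := fun ℓ f f' hf =>
    (ContinuousLinearMap.smulRightL ℝ (ℝ × ℝ × ℝ) E ℓ).hasFDerivAt.comp_hasDerivAt s hf
  exact ((key _ hA).add (key _ hB)).add (key _ hC)

theorem shift_mem_upper {θ : ℝ × ℝ × ℝ} (hθ : θ ∈ upper) (s : ℝ) : θ + (s, 0, 0) ∈ upper := by
  simpa [upper] using hθ

theorem hasDerivAt_shift (θ : ℝ × ℝ × ℝ) (s : ℝ) :
    HasDerivAt (fun s : ℝ => θ + (s, 0, 0)) (1, 0, 0) s :=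
  ((hasDerivAt_id s).prodMk (hasDerivAt_const s (0, 0))).const_add θ

section Flow

variable {H : Type*} [NormedAddCommGroup H] [InnerProductSpace ℂ H]

/-- The Gram operator `∫_X^∞ u ⊗ u* dX'` of the flow, where `u = V 0`. -/
def gram (V : ℕ → ℝ × ℝ × ℝ → H) (θ : ℝ × ℝ × ℝ) : H →L[ℂ] H :=
  ∫ s in Ioi (0 : ℝ), dyad V 0 0 (θ + (s, 0, 0))

/-- Minus the derivative of the Gram operator: it has finite rank in every direction. -/
def flux (V : ℕ → ℝ × ℝ × ℝ → H) (θ : ℝ × ℝ × ℝ) : ℝ × ℝ × ℝ →L[ℝ] H →L[ℂ] H :=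
  lin3 (dyad V 0 0 θ) ((Complex.I / 4) • (dyad V 1 0 θ - dyad V 0 1 θ))
    (-(dyad V 2 0 θ - dyad V 1 1 θ + dyad V 0 2 θ))

/-- The resolvent `(1 + G)⁻¹` of the Gram operator `G`. -/
def res (V : ℕ → ℝ × ℝ × ℝ → H) (θ : ℝ × ℝ × ℝ) : H →L[ℂ] H := Ring.inverse (1 + gram V θ)

/-- The matrix elements `S m n = ⟨V m, (1 + G)⁻¹ V n⟩`. -/
def elt (V : ℕ → ℝ × ℝ × ℝ → H) (m n : ℕ) (θ : ℝ × ℝ × ℝ) : ℂ :=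
  inner ℂ (V m θ) (res V θ (V n θ))

namespace IsFlow

variable {V : ℕ → ℝ × ℝ × ℝ → H} {ε : ℝ}

theorem hasDerivAt_dyad_shift (hV : IsFlow V ε) (m n : ℕ) {θ : ℝ × ℝ × ℝ} (hθ : θ ∈ upper)
    (s : ℝ) : HasDerivAt (fun s : ℝ => dyad V m n (θ + (s, 0, 0)))
      (dyad V (m + 1) n (θ + (s, 0, 0)) + dyad V m (n + 1) (θ + (s, 0, 0))) s := by
  have h := (hV.hasFDerivAt_dyad m n (shift_mem_upper hθ s)).comp_hasDerivAt s
    (hasDerivAt_shift θ s)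
  rwa [lin3_apply_fst] at h

theorem continuous_dyad_shift (hV : IsFlow V ε) (m n : ℕ) {θ : ℝ × ℝ × ℝ} (hθ : θ ∈ upper) :
    Continuous fun s : ℝ => dyad V m n (θ + (s, 0, 0)) :=
  continuous_iff_continuousAt.2 fun s => (hV.hasDerivAt_dyad_shift m n hθ s).continuousAt

theorem norm_dyad_shift_le (hV : IsFlow V ε) (m n : ℕ) {θ : ℝ × ℝ × ℝ} (hθ : θ ∈ upper)
    {s : ℝ} (hs : 0 ≤ s) :
    ‖dyad V m n (θ + (s, 0, 0))‖ ≤ Real.exp (-(2 * ε * s)) * (‖V m θ‖ * ‖V n θ‖) := by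
  rw [norm_dyad]
  refine (mul_le_mul (hV.norm_shift_le m θ hθ s hs) (hV.norm_shift_le n θ hθ s hs)
    (norm_nonneg _) (by positivity)).trans_eq ?_
  rw [mul_mul_mul_comm, ← Real.exp_add]
  ring_nf

theorem integrableOn_dyad_shift (hV : IsFlow V ε) (m n : ℕ) {θ : ℝ × ℝ × ℝ} (hθ : θ ∈ upper) :
    IntegrableOn (fun s : ℝ => dyad V m n (θ + (s, 0, 0))) (Ioi 0) :=
  integrableOn_Ioi_of_norm_le_exp (hV.continuous_dyad_shift m n hθ)
    (mul_pos two_pos hV.eps_pos) fun _ hs => hV.norm_dyad_shift_le m n hθ hs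

theorem tendsto_dyad_shift (hV : IsFlow V ε) (m n : ℕ) {θ : ℝ × ℝ × ℝ} (hθ : θ ∈ upper) :
    Tendsto (fun s : ℝ => dyad V m n (θ + (s, 0, 0))) atTop (𝓝 0) := by
  have h0 : Tendsto (fun s : ℝ => Real.exp (-(2 * ε * s)) * (‖V m θ‖ * ‖V n θ‖)) atTop (𝓝 0) := by
    have h1 : Tendsto (fun s : ℝ => 2 * ε * s) atTop atTop :=
      tendsto_id.const_mul_atTop (mul_pos two_pos hV.eps_pos)
    simpa using (Real.tendsto_exp_neg_atTop_nhds_zero.comp h1).mul_const (‖V m θ‖ * ‖V n θ‖)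
  refine squeeze_zero_norm' ?_ h0
  filter_upwards [eventually_ge_atTop 0] with s hs using hV.norm_dyad_shift_le m n hθ hs

/-- The derivative of `u ⊗ u*` along the flow is an exact `X`-derivative, namely that of
the flux. -/
theorem hasDerivAt_flux_shift (hV : IsFlow V ε) {θ : ℝ × ℝ × ℝ} (hθ : θ ∈ upper) (s : ℝ) :
    HasDerivAt (fun s : ℝ => flux V (θ + (s, 0, 0)))
      (lin3 (dyad V 1 0 (θ + (s, 0, 0)) + dyad V 0 1 (θ + (s, 0, 0)))
        ((Complex.I / 4) • (dyad V 2 0 (θ + (s, 0, 0)) - dyad V 0 2 (θ + (s, 0, 0))))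
        (-(dyad V 3 0 (θ + (s, 0, 0)) + dyad V 0 3 (θ + (s, 0, 0))))) s := by
  have h := fun m n => hV.hasDerivAt_dyad_shift m n hθ s
  refine hasDerivAt_lin3 (h 0 0) ?_ ?_
  · refine (((h 1 0).sub (h 0 1)).const_smul (Complex.I / 4)).congr_deriv ?_
    congr 1
    abel
  · refine (((h 2 0).sub (h 1 1)).add (h 0 2)).neg.congr_deriv ?_
    abel

theorem gram_apply (hV : IsFlow V ε) {θ : ℝ × ℝ × ℝ} (hθ : θ ∈ upper) (ψ : H) :
    gram V θ ψ = ∫ s in Ioi (0 : ℝ),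
      inner ℂ (V 0 (θ + (s, 0, 0))) ψ • V 0 (θ + (s, 0, 0)) :=
  ContinuousLinearMap.integral_apply (hV.integrableOn_dyad_shift 0 0 hθ) ψ

theorem tendsto_flux_shift (hV : IsFlow V ε) {θ : ℝ × ℝ × ℝ} (hθ : θ ∈ upper) :
    Tendsto (fun s : ℝ => flux V (θ + (s, 0, 0))) atTop (𝓝 0) := by
  have h := fun m n => hV.tendsto_dyad_shift m n hθ
  have h2 : Tendsto (fun s : ℝ => (Complex.I / 4) •
      (dyad V 1 0 (θ + (s, 0, 0)) - dyad V 0 1 (θ + (s, 0, 0)))) atTop (𝓝 0) := by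
    have h1 := ((h 1 0).sub (h 0 1)).const_smul (Complex.I / 4)
    rwa [sub_zero, smul_zero] at h1
  have h3 : Tendsto (fun s : ℝ => -(dyad V 2 0 (θ + (s, 0, 0)) - dyad V 1 1 (θ + (s, 0, 0))
      + dyad V 0 2 (θ + (s, 0, 0)))) atTop (𝓝 0) := by
    have h1 := (((h 2 0).sub (h 1 1)).add (h 0 2)).neg
    rwa [sub_zero, zero_add, neg_zero] at h1
  rw [← lin3_zero]
  exact tendsto_lin3 (h 0 0) h2 h3

variable [CompleteSpace H]

/-- Differentiation under the integral sign, followed by the fundamental theorem of calculus in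
`X`, which applies because the derivative of `u ⊗ u*` in every direction is an exact
`X`-derivative. -/
theorem hasFDerivAt_gram (hV : IsFlow V ε) {θ : ℝ × ℝ × ℝ} (hθ : θ ∈ upper) :
    HasFDerivAt (gram V) (-flux V θ) θ := by
  let F' : ℝ × ℝ × ℝ → ℝ → ℝ × ℝ × ℝ →L[ℝ] H →L[ℂ] H := fun θ s =>
    lin3 (dyad V 1 0 (θ + (s, 0, 0)) + dyad V 0 1 (θ + (s, 0, 0)))
      ((Complex.I / 4) • (dyad V 2 0 (θ + (s, 0, 0)) - dyad V 0 2 (θ + (s, 0, 0))))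
      (-(dyad V 3 0 (θ + (s, 0, 0)) + dyad V 0 3 (θ + (s, 0, 0))))
  let B : ℝ × ℝ × ℝ → ℝ := fun θ =>
    (‖V 1 θ‖ * ‖V 0 θ‖ + ‖V 0 θ‖ * ‖V 1 θ‖) + (‖V 2 θ‖ * ‖V 0 θ‖ + ‖V 0 θ‖ * ‖V 2 θ‖)
      + (‖V 3 θ‖ * ‖V 0 θ‖ + ‖V 0 θ‖ * ‖V 3 θ‖)
  have hBc : ContinuousAt B θ := by
    have h : ∀ n, ContinuousAt (fun θ => ‖V n θ‖) θ := fun n =>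
      (hV.hasFDerivAt n θ hθ).continuousAt.norm
    exact ((((h 1).mul (h 0)).add ((h 0).mul (h 1))).add
      (((h 2).mul (h 0)).add ((h 0).mul (h 2)))).add (((h 3).mul (h 0)).add ((h 0).mul (h 3)))
  have hF'c : ∀ θ ∈ upper, Continuous (F' θ) := by
    intro θ hθ
    have h := fun m n => hV.continuous_dyad_shift m n hθ
    have h2 : Continuous fun s : ℝ =>
        (Complex.I / 4) • (dyad V 2 0 (θ + (s, 0, 0)) - dyad V 0 2 (θ + (s, 0, 0))) :=
      ((h 2 0).sub (h 0 2)).const_smul (Complex.I / 4)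
    exact continuous_lin3 ((h 1 0).add (h 0 1)) h2 ((h 3 0).add (h 0 3)).neg
  have hF'b : ∀ θ ∈ upper, ∀ s : ℝ, 0 ≤ s → ‖F' θ s‖ ≤ Real.exp (-(2 * ε * s)) * B θ := by
    intro θ hθ s hs
    have h := fun m n => hV.norm_dyad_shift_le m n hθ hs
    have hI : ‖Complex.I / 4‖ ≤ 1 := by norm_num
    refine (norm_lin3_le _ _ _).trans ?_
    have h1 := (norm_add_le _ _).trans (add_le_add (h 1 0) (h 0 1))
    have h2 := (norm_sub_le _ _).trans (add_le_add (h 2 0) (h 0 2))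
    have h3 := (norm_add_le _ _).trans (add_le_add (h 3 0) (h 0 3))
    have h4 : ‖(Complex.I / 4) • (dyad V 2 0 (θ + (s, 0, 0)) - dyad V 0 2 (θ + (s, 0, 0)))‖ ≤
        ‖dyad V 2 0 (θ + (s, 0, 0)) - dyad V 0 2 (θ + (s, 0, 0))‖ := by
      rw [norm_smul]
      exact mul_le_of_le_one_left (norm_nonneg _) hI
    rw [norm_neg]
    refine (add_le_add (add_le_add h1 (h4.trans h2)) h3).trans_eq ?_
    simp only [B]
    ring
  have hF'i : IntegrableOn (F' θ) (Ioi 0) :=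
    integrableOn_Ioi_of_norm_le_exp (hF'c θ hθ) (mul_pos two_pos hV.eps_pos) (hF'b θ hθ)
  have hnhds : {θ' | θ' ∈ upper ∧ B θ' < B θ + 1} ∈ 𝓝 θ :=
    inter_mem (isOpen_upper.mem_nhds hθ) (hBc.eventually_lt_const (lt_add_one _))
  have hmain : HasFDerivAt (gram V) (∫ s in Ioi (0 : ℝ), F' θ s) θ := by
    refine hasFDerivAt_integral_of_dominated_of_fderiv_le (𝕜 := ℝ)
      (bound := fun s => Real.exp (-(2 * ε * s)) * (B θ + 1)) hnhds ?_
      (hV.integrableOn_dyad_shift 0 0 hθ) hF'i.aestronglyMeasurable ?_ ?_ ?_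
    · filter_upwards [isOpen_upper.mem_nhds hθ] with θ' hθ'
      exact (hV.continuous_dyad_shift 0 0 hθ').aestronglyMeasurable
    · filter_upwards [ae_restrict_mem measurableSet_Ioi] with s hs θ' hθ'
      exact (hF'b θ' hθ'.1 s (le_of_lt hs)).trans
        (mul_le_mul_of_nonneg_left hθ'.2.le (Real.exp_pos _).le)
    · simpa [neg_mul] using
        ((exp_neg_integrableOn_Ioi 0 (mul_pos two_pos hV.eps_pos)).mul_const (B θ + 1))
    · refine ae_of_all _ fun s θ' hθ' => ?_
      exact (hasFDerivAt_comp_add_right (s, 0, 0)).2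
        (hV.hasFDerivAt_dyad 0 0 (shift_mem_upper hθ'.1 s))
  refine hmain.congr_fderiv ?_
  rw [integral_Ioi_of_hasDerivAt_of_tendsto
    (hV.hasDerivAt_flux_shift hθ 0).continuousAt.continuousWithinAt
    (fun s _ => hV.hasDerivAt_flux_shift hθ s) hF'i (hV.tendsto_flux_shift hθ)]
  have h0 : θ + ((0 : ℝ), (0 : ℝ), (0 : ℝ)) = θ := add_zero θ
  rw [h0, zero_sub]

theorem contDiffOn_gram (hV : IsFlow V ε) : ContDiffOn ℝ ∞ (gram V) upper := by
  rw [contDiffOn_infty]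
  intro k
  have h := fun m n => (hV.contDiffOn_dyad m n).of_le (m := k) (by exact_mod_cast le_top)
  exact (contDiffOn_succ_of_hasFDerivAt_upper (fun θ hθ => hV.hasFDerivAt_gram hθ)
    (contDiffOn_lin3 (h 0 0) (((h 1 0).sub (h 0 1)).const_smul _)
      (((h 2 0).sub (h 1 1)).add (h 0 2)).neg).neg).of_le (by exact_mod_cast Nat.le_succ k)

/-- The Gram operator is positive: `⟨G ψ, ψ⟩ = ∫ |⟨u, ψ⟩|²`. -/
theorem inner_gram (hV : IsFlow V ε) {θ : ℝ × ℝ × ℝ} (hθ : θ ∈ upper) (ψ : H) :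
    ∃ r : ℝ, 0 ≤ r ∧ inner ℂ (gram V θ ψ) ψ = r := by
  refine ⟨∫ s in Ioi (0 : ℝ), ‖(inner ℂ (V 0 (θ + (s, 0, 0))) ψ : ℂ)‖ ^ 2,
    integral_nonneg fun s => by positivity, ?_⟩
  have hint : IntegrableOn (fun s : ℝ => dyad V 0 0 (θ + (s, 0, 0)) ψ) (Ioi 0) :=
    (ContinuousLinearMap.apply ℂ H ψ).integrable_comp (hV.integrableOn_dyad_shift 0 0 hθ)
  have hg : gram V θ ψ = ∫ s in Ioi (0 : ℝ), dyad V 0 0 (θ + (s, 0, 0)) ψ := hV.gram_apply hθ ψ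
  rw [← inner_conj_symm, hg, ← integral_inner hint, ← integral_conj]
  refine (integral_congr_ae (ae_of_all _ fun s => ?_)).trans (integral_ofReal (𝕜 := ℂ))
  rw [inner_conj_symm, dyad_apply, inner_smul_left, mul_comm, RCLike.mul_conj, RCLike.ofReal_pow]

/-- The lower bound that makes `1 + G` invertible. -/
theorem norm_sq_le_norm_inner (hV : IsFlow V ε) {θ : ℝ × ℝ × ℝ} (hθ : θ ∈ upper) (ψ : H) :
    ‖ψ‖ ^ 2 ≤ ‖(inner ℂ ((1 + gram V θ) ψ) ψ : ℂ)‖ := by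
  obtain ⟨r, hr, h⟩ := hV.inner_gram hθ ψ
  rw [add_apply, inner_add_left, h, one_apply_eq_self, inner_self_eq_norm_sq_to_K]
  have : ((‖ψ‖ : ℂ) ^ 2 + (r : ℂ)) = ((‖ψ‖ ^ 2 + r : ℝ) : ℂ) := by push_cast; rfl
  erw [this, Complex.norm_real, Real.norm_of_nonneg (by positivity)]
  linarith

theorem isUnit_one_add_gram (hV : IsFlow V ε) {θ : ℝ × ℝ × ℝ} (hθ : θ ∈ upper) :
    IsUnit (1 + gram V θ) :=
  ContinuousLinearMap.isUnit_of_forall_le_norm_inner_map _ (c := 1) one_pos fun ψ => by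
    rw [NNReal.coe_one, mul_one]
    exact hV.norm_sq_le_norm_inner hθ ψ

theorem res_add_gram_res (hV : IsFlow V ε) {θ : ℝ × ℝ × ℝ} (hθ : θ ∈ upper) (ψ : H) :
    res V θ ψ + gram V θ (res V θ ψ) = ψ := by
  have h := Ring.mul_inverse_cancel _ (hV.isUnit_one_add_gram hθ)
  exact congrArg (fun L : H →L[ℂ] H => L ψ) h

theorem eq_zero_of_add_gram_eq_zero (hV : IsFlow V ε) {θ : ℝ × ℝ × ℝ} (hθ : θ ∈ upper) {ψ : H}
    (h : ψ + gram V θ ψ = 0) : ψ = 0 := by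
  have h1 := hV.norm_sq_le_norm_inner hθ ψ
  have h2 : (1 + gram V θ) ψ = 0 := h
  rw [h2, inner_zero_left, norm_zero] at h1
  exact norm_eq_zero.1 (pow_eq_zero_iff two_ne_zero |>.1 (le_antisymm h1 (by positivity)))

theorem norm_res_apply_le (hV : IsFlow V ε) {θ : ℝ × ℝ × ℝ} (hθ : θ ∈ upper) (ψ : H) :
    ‖res V θ ψ‖ ≤ ‖ψ‖ := by
  have h1 := hV.norm_sq_le_norm_inner hθ (res V θ ψ)
  have h2 : (1 + gram V θ) (res V θ ψ) = ψ := hV.res_add_gram_res hθ ψ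
  rw [h2] at h1
  have h3 := h1.trans (norm_inner_le_norm _ _)
  rcases (norm_nonneg (res V θ ψ)).eq_or_lt with h | h
  · rw [← h]; exact norm_nonneg _
  · rw [pow_two] at h3
    exact le_of_mul_le_mul_right h3 h

theorem norm_elt_le (hV : IsFlow V ε) {θ : ℝ × ℝ × ℝ} (hθ : θ ∈ upper) (m n : ℕ) :
    ‖elt V m n θ‖ ≤ ‖V m θ‖ * ‖V n θ‖ :=
  (norm_inner_le_norm _ _).trans
    (mul_le_mul_of_nonneg_left (hV.norm_res_apply_le hθ _) (norm_nonneg _))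

/-- With `ψ = (1 + G)⁻¹ u`, one has `⟨u, ψ⟩ = ‖ψ‖² + ⟨G ψ, ψ⟩`, which is real. -/
theorem elt_zero_zero_im (hV : IsFlow V ε) {θ : ℝ × ℝ × ℝ} (hθ : θ ∈ upper) :
    (elt V 0 0 θ).im = 0 := by
  obtain ⟨r, -, h⟩ := hV.inner_gram hθ (res V θ (V 0 θ))
  have h2 := hV.res_add_gram_res hθ (V 0 θ)
  unfold elt
  nth_rewrite 1 [← h2]
  rw [inner_add_left, h, inner_self_eq_norm_sq_to_K, Complex.add_im, Complex.ofReal_im, add_zero]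
  norm_cast

theorem hasFDerivAt_res (hV : IsFlow V ε) {θ : ℝ × ℝ × ℝ} (hθ : θ ∈ upper) :
    HasFDerivAt (res V)
      ((ContinuousLinearMap.mulLeftRight ℝ (H →L[ℂ] H) (res V θ) (res V θ)).comp (flux V θ)) θ := by
  obtain ⟨x, hx⟩ := hV.isUnit_one_add_gram hθ
  have h1 := hasFDerivAt_ringInverse (𝕜 := ℝ) x
  have hr : res V θ = ↑x⁻¹ := by rw [res, ← hx, Ring.inverse_unit]
  rw [hx] at h1
  refine (h1.comp θ ((hV.hasFDerivAt_gram hθ).const_add 1)).congr_fderiv ?_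
  rw [hr]
  refine ContinuousLinearMap.ext fun η => ?_
  simp

theorem contDiffOn_res (hV : IsFlow V ε) : ContDiffOn ℝ ∞ (res V) upper := by
  intro θ hθ
  obtain ⟨x, hx⟩ := hV.isUnit_one_add_gram hθ
  have h1 := contDiffAt_ringInverse ℝ (n := ∞) x
  rw [hx] at h1
  exact h1.comp_contDiffWithinAt θ (contDiffWithinAt_const.add (hV.contDiffOn_gram θ hθ))

end IsFlow
end Flow

/-! ### The matrix elements of the resolvent -/

/-- The change of variables `(x, y, t) ↦ (x + y² t / 48, y t, t)`, which turns the Johnson equation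
into the KP equation. -/
def toKP (x y t : ℝ) : ℝ × ℝ × ℝ := (x + y ^ 2 * t / 48, y * t, t)

theorem toKP_mem_upper (x y : ℝ) {t : ℝ} (ht : 0 < t) : toKP x y t ∈ upper := ht

theorem toKP_add (x s y t : ℝ) : toKP (x + s) y t = toKP x y t + (s, 0, 0) := by
  ext <;> simp [toKP]; ring

theorem contDiff_toKP : ContDiff ℝ ∞ fun w : ℝ × ℝ × ℝ => toKP w.1 w.2.1 w.2.2 := by
  unfold toKP
  fun_prop

theorem hasDerivAt_toKP_x (x y t : ℝ) : HasDerivAt (fun x => toKP x y t) (1, 0, 0) x :=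
  ((hasDerivAt_id x).add_const _).prodMk ((hasDerivAt_const x _).prodMk (hasDerivAt_const x _))

theorem hasDerivAt_toKP_y (x y t : ℝ) :
    HasDerivAt (fun y => toKP x y t) (y * t / 24, t, 0) y := by
  refine HasDerivAt.prodMk ?_ (HasDerivAt.prodMk ?_ (hasDerivAt_const y _))
  · refine ((((hasDerivAt_pow 2 y).mul_const t).div_const 48).const_add x).congr_deriv ?_
    norm_num
    ring
  · simpa using (hasDerivAt_id y).mul_const t

theorem hasDerivAt_toKP_t (x y t : ℝ) :
    HasDerivAt (fun t => toKP x y t) (y ^ 2 / 48, y, 1) t := by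
  refine HasDerivAt.prodMk ?_ (HasDerivAt.prodMk ?_ (hasDerivAt_id t))
  · simpa using (((hasDerivAt_id t).const_mul (y ^ 2)).div_const 48).const_add x
  · simpa using (hasDerivAt_id t).const_mul y

section Flow

variable {H : Type*} [NormedAddCommGroup H] [InnerProductSpace ℂ H]

theorem isBoundedBilinearMap_clm_apply : IsBoundedBilinearMap ℝ
    (fun p : (H →L[ℂ] H) × H => p.1 p.2) where
  add_left _ _ _ := rfl
  smul_left _ _ _ := rfl
  add_right x _ _ := map_add x _ _
  smul_right c x y := by
    rw [← Complex.coe_smul, map_smul, Complex.coe_smul]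
  bound := ⟨1, one_pos, fun x y => by rw [one_mul]; exact x.le_opNorm y⟩

/-- The value at `θ` of a polynomial in the matrix elements. -/
def jetEval (V : ℕ → ℝ × ℝ × ℝ → H) (θ : ℝ × ℝ × ℝ) : JetRing →ₐ[ℂ] ℂ :=
  MvPolynomial.aeval fun i => elt V i.1 i.2 θ

theorem jetEval_jet (V : ℕ → ℝ × ℝ × ℝ → H) (θ : ℝ × ℝ × ℝ) (m n : ℕ) :
    jetEval V θ (jet m n) = elt V m n θ := MvPolynomial.aeval_X ..

theorem jetEval_solutionJet (V : ℕ → ℝ × ℝ × ℝ → H) (θ : ℝ × ℝ × ℝ) :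
    jetEval V θ solutionJet = -2 * (elt V 1 0 θ + elt V 0 1 θ + elt V 0 0 θ * elt V 0 0 θ) := by
  simp only [solutionJet, map_smul, dX_jet, map_add, map_mul, jetEval_jet, smul_eq_mul, zero_add]

/-- The pairing `⟨V m (Z, Y, T), V n (X, Y, T)⟩` in the variables `x, z, y, t`, where
`(X, Y, T) = toKP x y t` and `(Z, Y, T) = toKP z y t`. For `m = n = 0` it is the kernel `F`. -/
def pairing (V : ℕ → ℝ × ℝ × ℝ → H) (m n : ℕ) (x z y t : ℝ) : ℂ :=
  inner ℂ (V m (toKP z y t)) (V n (toKP x y t))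

/-- The solution of the Marchenko equation, `K(x, z) = -⟨u(z), (1 + G(x))⁻¹ u(x)⟩` with
`u = V 0`. -/
def marchenkoKernel (V : ℕ → ℝ × ℝ × ℝ → H) (x z y t : ℝ) : ℂ :=
  -inner ℂ (V 0 (toKP z y t)) (res V (toKP x y t) (V 0 (toKP x y t)))

/-- The real part of a polynomial in the matrix elements, in the variables `x, y, t` of the
Johnson equation. -/
def jetRe (V : ℕ → ℝ × ℝ × ℝ → H) (P : JetRing) (x y t : ℝ) : ℝ :=
  (jetEval V (toKP x y t) P).re

namespace IsFlow

variable {V : ℕ → ℝ × ℝ × ℝ → H} {ε : ℝ}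

section Pairing

theorem hasDerivAt_x (hV : IsFlow V ε) (n : ℕ) (x y : ℝ) {t : ℝ} (ht : 0 < t) :
    HasDerivAt (fun x => V n (toKP x y t)) (V (n + 1) (toKP x y t)) x := by
  have h := (hV.hasFDerivAt n _ (toKP_mem_upper x y ht)).comp_hasDerivAt x
    (hasDerivAt_toKP_x x y t)
  rwa [lin3_apply_fst] at h

theorem hasDerivAt_y (hV : IsFlow V ε) (n : ℕ) (x y : ℝ) {t : ℝ} (ht : 0 < t) :
    HasDerivAt (fun y => V n (toKP x y t)) ((y * t / 24 : ℂ) • V (n + 1) (toKP x y t)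
      + (t * (Complex.I / 4) : ℂ) • V (n + 2) (toKP x y t)) y := by
  have h := (hV.hasFDerivAt n _ (toKP_mem_upper x y ht)).comp_hasDerivAt y
    (hasDerivAt_toKP_y x y t)
  rw [lin3_apply, zero_smul, add_zero, ← Complex.coe_smul, ← Complex.coe_smul, smul_smul] at h
  push_cast at h
  exact h

theorem hasDerivAt_t (hV : IsFlow V ε) (n : ℕ) (x y : ℝ) {t : ℝ} (ht : 0 < t) :
    HasDerivAt (fun t => V n (toKP x y t)) ((y ^ 2 / 48 : ℂ) • V (n + 1) (toKP x y t)
      + (y * (Complex.I / 4) : ℂ) • V (n + 2) (toKP x y t) - V (n + 3) (toKP x y t)) t := by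
  have h := (hV.hasFDerivAt n _ (toKP_mem_upper x y ht)).comp_hasDerivAt t
    (hasDerivAt_toKP_t x y t)
  rw [lin3_apply, one_smul, ← Complex.coe_smul, ← Complex.coe_smul, smul_smul,
    ← sub_eq_add_neg] at h
  push_cast at h
  exact h

theorem hasDerivAt_pairing_x (hV : IsFlow V ε) (m n : ℕ) (x z y : ℝ) {t : ℝ} (ht : 0 < t) :
    HasDerivAt (fun x => pairing V m n x z y t) (pairing V m (n + 1) x z y t) x := by
  simpa [pairing] using (hasDerivAt_const x (V m (toKP z y t))).inner ℂ (hV.hasDerivAt_x n x y ht)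

theorem hasDerivAt_pairing_z (hV : IsFlow V ε) (m n : ℕ) (x z y : ℝ) {t : ℝ} (ht : 0 < t) :
    HasDerivAt (fun z => pairing V m n x z y t) (pairing V (m + 1) n x z y t) z := by
  simpa [pairing] using (hV.hasDerivAt_x m z y ht).inner ℂ (hasDerivAt_const z (V n (toKP x y t)))

theorem hasDerivAt_pairing_y (hV : IsFlow V ε) (m n : ℕ) (x z y : ℝ) {t : ℝ} (ht : 0 < t) :
    HasDerivAt (fun y => pairing V m n x z y t)
      (y * t / 24 * (pairing V m (n + 1) x z y t + pairing V (m + 1) n x z y t)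
        + t * (Complex.I / 4) * (pairing V m (n + 2) x z y t - pairing V (m + 2) n x z y t)) y := by
  refine ((hV.hasDerivAt_y m z y ht).inner ℂ (hV.hasDerivAt_y n x y ht)).congr_deriv ?_
  simp only [pairing, inner_add_left, inner_add_right, inner_smul_left, inner_smul_right, map_mul,
    map_div₀, Complex.conj_I, Complex.conj_ofReal, map_ofNat]
  ring

theorem hasDerivAt_pairing_t (hV : IsFlow V ε) (m n : ℕ) (x z y : ℝ) {t : ℝ} (ht : 0 < t) :
    HasDerivAt (fun t => pairing V m n x z y t)
      (y ^ 2 / 48 * (pairing V m (n + 1) x z y t + pairing V (m + 1) n x z y t)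
        + y * (Complex.I / 4) * (pairing V m (n + 2) x z y t - pairing V (m + 2) n x z y t)
        - (pairing V m (n + 3) x z y t + pairing V (m + 3) n x z y t)) t := by
  refine ((hV.hasDerivAt_t m z y ht).inner ℂ (hV.hasDerivAt_t n x y ht)).congr_deriv ?_
  simp only [pairing, inner_add_left, inner_add_right, inner_sub_left, inner_sub_right,
    inner_smul_left, inner_smul_right, map_mul, map_pow,
    map_div₀, Complex.conj_I, Complex.conj_ofReal, map_ofNat]
  ring

theorem iteratedDeriv_pairing_x (hV : IsFlow V ε) (k m n : ℕ) (z y : ℝ) {t : ℝ} (ht : 0 < t) :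
    iteratedDeriv k (fun x => pairing V m n x z y t) = fun x => pairing V m (n + k) x z y t := by
  induction k with
  | zero => rfl
  | succ k ih =>
    rw [iteratedDeriv_succ, ih]
    exact funext fun x => (hV.hasDerivAt_pairing_x m (n + k) x z y ht).deriv

theorem iteratedDeriv_pairing_z (hV : IsFlow V ε) (k m n : ℕ) (x y : ℝ) {t : ℝ} (ht : 0 < t) :
    iteratedDeriv k (fun z => pairing V m n x z y t) = fun z => pairing V (m + k) n x z y t := by
  induction k with
  | zero => rfl
  | succ k ih =>
    rw [iteratedDeriv_succ, ih]
    exact funext fun z => (hV.hasDerivAt_pairing_z (m + k) n x z y ht).deriv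

theorem solvesLinearSystem (hV : IsFlow V ε) : SolvesLinearSystem Complex.I (pairing V 0 0) := by
  intro x z y t ht
  rw [(hV.hasDerivAt_pairing_t 0 0 x z y ht).deriv, (hV.hasDerivAt_pairing_x 0 0 x z y ht).deriv,
    (hV.hasDerivAt_pairing_z 0 0 x z y ht).deriv, (hV.hasDerivAt_pairing_y 0 0 x z y ht).deriv,
    hV.iteratedDeriv_pairing_x 2 0 0 z y ht, hV.iteratedDeriv_pairing_x 3 0 0 z y ht,
    hV.iteratedDeriv_pairing_z 2 0 0 x y ht, hV.iteratedDeriv_pairing_z 3 0 0 x y ht]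
  have h4 : (y : ℂ) / (4 * Complex.I) = -(y * (Complex.I / 4)) := by
    field_simp
    rw [Complex.I_sq]
    ring
  have h24 : (y : ℂ) * t / (24 * Complex.I) = -(y * t / 24 * Complex.I) := by
    field_simp
    rw [Complex.I_sq]
    ring
  rw [h4, h24, Complex.I_sq]
  simp only [zero_add]
  constructor
  · ring
  · linear_combination (t / 4 * (pairing V 0 2 x z y t - pairing V 2 0 x z y t)) * Complex.I_sq

theorem contDiffOn_pairing (hV : IsFlow V ε) (m n : ℕ) :
    ContDiffOn ℝ ∞ (fun w : ℝ × ℝ × ℝ × ℝ => pairing V m n w.1 w.2.1 w.2.2.1 w.2.2.2)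
      {w | 0 < w.2.2.2} := by
  have h1 : ContDiff ℝ ∞ fun w : ℝ × ℝ × ℝ × ℝ => toKP w.1 w.2.2.1 w.2.2.2 := by
    unfold toKP; fun_prop
  have h2 : ContDiff ℝ ∞ fun w : ℝ × ℝ × ℝ × ℝ => toKP w.2.1 w.2.2.1 w.2.2.2 := by
    unfold toKP; fun_prop
  exact ((hV.contDiffOn m).comp h2.contDiffOn fun w hw => hw).inner ℂ
    ((hV.contDiffOn n).comp h1.contDiffOn fun w hw => hw)

end Pairing

variable [CompleteSpace H]

/-- The matrix elements obey the rules that define `dX`, `dY`, `dT`, since the derivative of the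
resolvent is `R (flux) R` and the flux has finite rank. -/
theorem hasFDerivAt_elt (hV : IsFlow V ε) (m n : ℕ) {θ : ℝ × ℝ × ℝ} (hθ : θ ∈ upper) :
    HasFDerivAt (elt V m n) (lin3 (jetEval V θ (dX (jet m n))) (jetEval V θ (dY (jet m n)))
      (jetEval V θ (dT (jet m n)))) θ := by
  have h1 := (isBoundedBilinearMap_clm_apply.hasFDerivAt (res V θ, V n θ)).comp θ
    ((hV.hasFDerivAt_res hθ).prodMk (hV.hasFDerivAt n θ hθ))
  refine ((hV.hasFDerivAt m θ hθ).inner ℂ h1).congr_fderiv ?_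
  refine lin3_ext ?_ ?_ ?_ <;>
    simp only [ContinuousLinearMap.comp_apply, ContinuousLinearMap.prod_apply, lin3_apply_fst,
      lin3_apply_snd, lin3_apply_trd, IsBoundedBilinearMap.deriv_apply, dyad_apply, flux,
      fderivInnerCLM_apply, ContinuousLinearMap.mulLeftRight_apply,
      mul_apply_eq_comp, dX_jet, dY_apply, dY'_jet, dT_jet, map_add, map_sub, map_neg,
      map_mul, map_smul, jetEval_jet, elt, Function.comp_apply,
      add_apply, sub_apply, neg_apply, smul_apply, inner_smul_left, inner_smul_right,
      inner_add_right, inner_sub_right, inner_neg_right,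
      inner_neg_left, map_div₀, Complex.conj_I, map_ofNat, smul_eq_mul]
  · ring
  · ring
  · ring

theorem contDiffOn_elt (hV : IsFlow V ε) (m n : ℕ) : ContDiffOn ℝ ∞ (elt V m n) upper :=
  (hV.contDiffOn m).inner ℂ ((isBoundedBilinearMap_clm_apply (H := H)).contDiff.comp_contDiffOn
    (hV.contDiffOn_res.prodMk (hV.contDiffOn n)))

theorem hasFDerivAt_jetEval (hV : IsFlow V ε) (P : JetRing) {θ : ℝ × ℝ × ℝ} (hθ : θ ∈ upper) :
    HasFDerivAt (fun θ => jetEval V θ P)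
      (lin3 (jetEval V θ (dX P)) (jetEval V θ (dY P)) (jetEval V θ (dT P))) θ := by
  induction P using MvPolynomial.induction_on with
  | C a =>
    have hC : ∀ D : Derivation ℂ JetRing JetRing, D (MvPolynomial.C a) = 0 :=
      fun D => D.map_algebraMap a
    simp only [hC, map_zero, lin3_zero, jetEval, MvPolynomial.aeval_C]
    exact hasFDerivAt_const _ _
  | add p q hp hq =>
    simp only [map_add]
    refine (hp.add hq).congr_fderiv (lin3_ext ?_ ?_ ?_) <;> simp
  | mul_X p i hp =>
    have hi := hV.hasFDerivAt_elt i.1 i.2 hθ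
    have hX : (MvPolynomial.X i : JetRing) = jet i.1 i.2 := rfl
    simp only [map_mul, hX, jetEval_jet]
    refine (hp.mul hi).congr_fderiv (lin3_ext ?_ ?_ ?_) <;>
      simp [Derivation.leibniz, jetEval_jet]

theorem contDiffOn_jetEval (hV : IsFlow V ε) (P : JetRing) :
    ContDiffOn ℝ ∞ (fun θ => jetEval V θ P) upper := by
  induction P using MvPolynomial.induction_on with
  | C a => simpa only [jetEval, MvPolynomial.aeval_C] using contDiffOn_const
  | add p q hp hq => simpa only [map_add] using hp.add hq
  | mul_X p i hp =>
    have hX : (MvPolynomial.X i : JetRing) = jet i.1 i.2 := rfl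
    simpa only [map_mul, hX, jetEval_jet] using hp.mul (hV.contDiffOn_elt i.1 i.2)

end IsFlow
end Flow

/-! ### The Johnson equation, decay, and the Marchenko equation -/

theorem measurePreserving_Ioi_shift (x : ℝ) :
    MeasurePreserving (fun s : ℝ => x + s) (volume.restrict (Ioi 0)) (volume.restrict (Ioi x)) := by
  have h := (measurePreserving_add_left (volume : Measure ℝ) x).restrict_preimage
    (measurableSet_Ioi (a := x))
  simpa using h

section Flow

variable {H : Type*} [NormedAddCommGroup H] [InnerProductSpace ℂ H]

namespace IsFlow

variable {V : ℕ → ℝ × ℝ × ℝ → H} {ε : ℝ}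

theorem continuous_toKP (hV : IsFlow V ε) (n : ℕ) (y : ℝ) {t : ℝ} (ht : 0 < t) :
    Continuous fun x => V n (toKP x y t) :=
  continuous_iff_continuousAt.2 fun x => (hV.hasDerivAt_x n x y ht).continuousAt

theorem memLp_toKP (hV : IsFlow V ε) (x y : ℝ) {t : ℝ} (ht : 0 < t) :
    MemLp (fun ξ => V 0 (toKP ξ y t)) 2 (volume.restrict (Ioi x)) := by
  refine (memLp_two_iff_integrable_sq_norm
    (hV.continuous_toKP 0 y ht).aestronglyMeasurable).2 ?_
  have h := (hV.integrableOn_dyad_shift 0 0 (toKP_mem_upper x y ht)).norm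
  refine ((measurePreserving_Ioi_shift x).integrable_comp_emb
    (measurableEmbedding_addLeft x)).1 ?_
  simpa only [Function.comp_def, toKP_add, norm_dyad, pow_two] using h

theorem integrableOn_inner_smul (hV : IsFlow V ε) (x y : ℝ) {t : ℝ} (ht : 0 < t) (ψ : H) :
    IntegrableOn (fun ξ => inner ℂ (V 0 (toKP ξ y t)) ψ • V 0 (toKP ξ y t)) (Ioi x) := by
  have h := (ContinuousLinearMap.apply ℂ H ψ).integrable_comp
    (hV.integrableOn_dyad_shift 0 0 (toKP_mem_upper x y ht))
  refine ((measurePreserving_Ioi_shift x).integrable_comp_emb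
    (measurableEmbedding_addLeft x)).1 ?_
  refine h.congr (ae_of_all _ fun s => ?_)
  simp only [Function.comp_apply, toKP_add]
  rfl

theorem memLp_marchenkoKernel (hV : IsFlow V ε) (x y : ℝ) {t : ℝ} (ht : 0 < t) :
    MemLp (fun z => marchenkoKernel V x z y t) 2 (volume.restrict (Ici x)) := by
  rw [← Measure.restrict_congr_set Ioi_ae_eq_Ici]
  refine ((hV.memLp_toKP x y ht).inner_const (𝕜 := ℂ) _).neg

theorem gram_toKP_apply (hV : IsFlow V ε) (x y : ℝ) {t : ℝ} (ht : 0 < t) (ψ : H) :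
    gram V (toKP x y t) ψ =
      ∫ ξ in Ioi x, inner ℂ (V 0 (toKP ξ y t)) ψ • V 0 (toKP ξ y t) := by
  rw [hV.gram_apply (toKP_mem_upper x y ht), ← (measurePreserving_Ioi_shift x).integral_comp
    (measurableEmbedding_addLeft x)]
  simp only [toKP_add]

variable [CompleteSpace H]

theorem hasDerivAt_jetRe_x (hV : IsFlow V ε) (P : JetRing) (x y : ℝ) {t : ℝ} (ht : 0 < t) :
    HasDerivAt (fun x => jetRe V P x y t) (jetRe V (dX P) x y t) x := by
  have h := (hV.hasFDerivAt_jetEval P (toKP_mem_upper x y ht)).comp_hasDerivAt x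
    (hasDerivAt_toKP_x x y t)
  have h2 := Complex.reCLM.hasFDerivAt.comp_hasDerivAt x h
  rwa [lin3_apply_fst] at h2

theorem hasDerivAt_jetRe_y (hV : IsFlow V ε) (P : JetRing) (x y : ℝ) {t : ℝ} (ht : 0 < t) :
    HasDerivAt (fun y => jetRe V P x y t)
      (y * t / 24 * jetRe V (dX P) x y t + t * jetRe V (dY P) x y t) y := by
  have h := (hV.hasFDerivAt_jetEval P (toKP_mem_upper x y ht)).comp_hasDerivAt y
    (hasDerivAt_toKP_y x y t)
  refine (Complex.reCLM.hasFDerivAt.comp_hasDerivAt y h).congr_deriv ?_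
  simp [lin3_apply, jetRe]

theorem hasDerivAt_jetRe_t (hV : IsFlow V ε) (P : JetRing) (x y : ℝ) {t : ℝ} (ht : 0 < t) :
    HasDerivAt (fun t => jetRe V P x y t)
      (y ^ 2 / 48 * jetRe V (dX P) x y t + y * jetRe V (dY P) x y t + jetRe V (dT P) x y t) t := by
  have h := (hV.hasFDerivAt_jetEval P (toKP_mem_upper x y ht)).comp_hasDerivAt t
    (hasDerivAt_toKP_t x y t)
  refine (Complex.reCLM.hasFDerivAt.comp_hasDerivAt t h).congr_deriv ?_
  simp only [lin3_apply, jetRe, Complex.reCLM_apply, Complex.add_re, Complex.real_smul,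
    Complex.re_ofReal_mul, one_mul, Complex.ofReal_one]

theorem contDiffOn_jetRe (hV : IsFlow V ε) (P : JetRing) :
    ContDiffOn ℝ ∞ (fun w : ℝ × ℝ × ℝ => jetRe V P w.1 w.2.1 w.2.2) {w | 0 < w.2.2} :=
  Complex.reCLM.contDiff.comp_contDiffOn
    ((hV.contDiffOn_jetEval P).comp contDiff_toKP.contDiffOn fun _ hw => hw)

theorem hasDerivAt_marchenkoKernel_diag (hV : IsFlow V ε) (x y : ℝ) {t : ℝ} (ht : 0 < t) :
    HasDerivAt (fun x => 2 * marchenkoKernel V x x y t)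
      (jetEval V (toKP x y t) solutionJet) x := by
  have h := (hV.hasFDerivAt_elt 0 0 (toKP_mem_upper x y ht)).comp_hasDerivAt x
    (hasDerivAt_toKP_x x y t)
  rw [lin3_apply_fst] at h
  have h2 := h.neg.const_mul (2 : ℂ)
  refine h2.congr_deriv ?_
  rw [solutionJet, map_smul, smul_eq_mul]
  ring

/-- `K(x, x, y, t)` is real, hence so is its `x`-derivative. -/
theorem jetEval_solutionJet_im (hV : IsFlow V ε) (x y : ℝ) {t : ℝ} (ht : 0 < t) :
    (jetEval V (toKP x y t) solutionJet).im = 0 := by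
  have h := Complex.imCLM.hasFDerivAt.comp_hasDerivAt x
    (hV.hasDerivAt_marchenkoKernel_diag x y ht)
  have h0 : (Complex.imCLM ∘ fun x => 2 * marchenkoKernel V x x y t) = fun _ => 0 := by
    funext x
    have h1 : (elt V 0 0 (toKP x y t)).im = 0 := hV.elt_zero_zero_im (toKP_mem_upper x y ht)
    have h2 : marchenkoKernel V x x y t = -elt V 0 0 (toKP x y t) := rfl
    simp [h2, h1]
  rw [h0] at h
  exact h.unique (hasDerivAt_const x 0)

theorem coe_jetRe_solutionJet (hV : IsFlow V ε) (x y : ℝ) {t : ℝ} (ht : 0 < t) :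
    ((jetRe V solutionJet x y t : ℝ) : ℂ) = jetEval V (toKP x y t) solutionJet :=
  Complex.ext rfl (hV.jetEval_solutionJet_im x y ht).symm

theorem iteratedDeriv_jetRe_x (hV : IsFlow V ε) (k : ℕ) (P : JetRing) (y : ℝ) {t : ℝ}
    (ht : 0 < t) :
    iteratedDeriv k (fun x => jetRe V P x y t) = fun x => jetRe V (dX^[k] P) x y t := by
  induction k generalizing P with
  | zero => rfl
  | succ k ih =>
    rw [iteratedDeriv_succ', Function.iterate_succ_apply, ← ih]
    exact congrArg _ (funext fun x => (hV.hasDerivAt_jetRe_x P x y ht).deriv)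

theorem iteratedDeriv_two_jetRe_y (hV : IsFlow V ε) (P : JetRing) (x y : ℝ) {t : ℝ}
    (ht : 0 < t) :
    iteratedDeriv 2 (fun y => jetRe V P x y t) y =
      t / 24 * jetRe V (dX P) x y t
        + y * t / 24 * (y * t / 24 * jetRe V (dX (dX P)) x y t + t * jetRe V (dY (dX P)) x y t)
        + t * (y * t / 24 * jetRe V (dX (dY P)) x y t + t * jetRe V (dY (dY P)) x y t) := by
  rw [iteratedDeriv_succ', iteratedDeriv_one,
    show deriv (fun y => jetRe V P x y t) = _ from
      funext fun y => (hV.hasDerivAt_jetRe_y P x y ht).deriv]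
  have h1 : HasDerivAt (fun y : ℝ => y * t / 24) (t / 24) y := by
    simpa using ((hasDerivAt_id y).mul_const t).div_const 24
  exact ((h1.mul (hV.hasDerivAt_jetRe_y (dX P) x y ht)).add
    ((hV.hasDerivAt_jetRe_y (dY P) x y ht).const_mul t)).deriv

/-- In the variables of `toKP` the Johnson equation is the KP equation: the terms in `v_x / (2t)`,
`y² v_xx / 48` and `y v_xY` cancel. -/
theorem solvesJohnson (hV : IsFlow V ε) : SolvesJohnson (-1) (jetRe V solutionJet) := by
  intro x y t ht
  have h1 : ∀ x, 3 / 2 * jetRe V solutionJet x y t * jetRe V (dX solutionJet) x y t =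
      jetRe V ((3 / 2 : ℂ) • (solutionJet * dX solutionJet)) x y t := by
    intro x
    have h32 : (3 / 2 : ℂ) = ((3 / 2 : ℝ) : ℂ) := by norm_num
    simp only [jetRe, map_smul, map_mul, smul_eq_mul, h32, Complex.re_ofReal_mul]
    rw [Complex.mul_re, hV.jetEval_solutionJet_im x y ht]
    ring
  have hx := fun P => hV.hasDerivAt_jetRe_x P x y ht
  have hv : deriv (fun x' => deriv (fun t' => jetRe V solutionJet x' y t') t
        + 1 / 4 * iteratedDeriv 3 (fun x'' => jetRe V solutionJet x'' y t) x'
        + 3 / 2 * jetRe V solutionJet x' y t * deriv (fun x'' => jetRe V solutionJet x'' y t) x'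
        + jetRe V solutionJet x' y t / (2 * t)) x =
      (y ^ 2 / 48 * jetRe V (dX (dX solutionJet)) x y t
        + y * jetRe V (dX (dY solutionJet)) x y t + jetRe V (dX (dT solutionJet)) x y t)
        + 1 / 4 * jetRe V (dX (dX (dX (dX solutionJet)))) x y t
        + jetRe V (dX ((3 / 2 : ℂ) • (solutionJet * dX solutionJet))) x y t
        + jetRe V (dX solutionJet) x y t / (2 * t) := by
    have hfun : (fun x' => deriv (fun t' => jetRe V solutionJet x' y t') t
        + 1 / 4 * iteratedDeriv 3 (fun x'' => jetRe V solutionJet x'' y t) x'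
        + 3 / 2 * jetRe V solutionJet x' y t * deriv (fun x'' => jetRe V solutionJet x'' y t) x'
        + jetRe V solutionJet x' y t / (2 * t)) = fun x =>
      (y ^ 2 / 48 * jetRe V (dX solutionJet) x y t
        + y * jetRe V (dY solutionJet) x y t + jetRe V (dT solutionJet) x y t)
        + 1 / 4 * jetRe V (dX (dX (dX solutionJet))) x y t
        + jetRe V ((3 / 2 : ℂ) • (solutionJet * dX solutionJet)) x y t
        + jetRe V solutionJet x y t / (2 * t) := by
      funext x'
      rw [(hV.hasDerivAt_jetRe_t solutionJet x' y ht).deriv,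
        (hV.hasDerivAt_jetRe_x solutionJet x' y ht).deriv,
        hV.iteratedDeriv_jetRe_x 3 solutionJet y ht, h1 x']
      rfl
    rw [hfun]
    exact ((((((hx _).const_mul _).add ((hx _).const_mul _)).add (hx _)).add
      ((hx _).const_mul _)).add (hx _)).add ((hx _).div_const _) |>.deriv
  rw [hv, hV.iteratedDeriv_two_jetRe_y solutionJet x y ht, ← dX_dY_comm]
  have hkp := congrArg (fun P => jetRe V P x y t) kp
  have h14 : (1 / 4 : ℂ) = ((1 / 4 : ℝ) : ℂ) := by norm_num
  have h12 : (12 : ℂ) = ((12 : ℝ) : ℂ) := by norm_num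
  have hadd : ∀ P Q : JetRing, jetRe V (P + Q) x y t = jetRe V P x y t + jetRe V Q x y t :=
    fun P Q => by simp [jetRe]
  have hsmul : ∀ (r : ℝ) (P : JetRing), jetRe V ((r : ℂ) • P) x y t = r * jetRe V P x y t :=
    fun r P => by simp only [jetRe, map_smul, smul_eq_mul, Complex.re_ofReal_mul]
  simp only [map_add, hadd] at hkp
  rw [h14, h12, hsmul, Derivation.map_smul, hsmul] at hkp
  have hne : t ≠ 0 := ht.ne'
  have hr : -(12 * -1 / t ^ 2) * (t / 24 * jetRe V (dX solutionJet) x y t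
        + y * t / 24 * (y * t / 24 * jetRe V (dX (dX solutionJet)) x y t
          + t * jetRe V (dX (dY solutionJet)) x y t)
        + t * (y * t / 24 * jetRe V (dX (dY solutionJet)) x y t
          + t * jetRe V (dY (dY solutionJet)) x y t)) =
      jetRe V (dX solutionJet) x y t / (2 * t) + y ^ 2 / 48 * jetRe V (dX (dX solutionJet)) x y t
        + y * jetRe V (dX (dY solutionJet)) x y t + 12 * jetRe V (dY (dY solutionJet)) x y t := by
    field_simp
    ring
  rw [hr]
  linear_combination hkp

theorem norm_jetEval_solutionJet_le (hV : IsFlow V ε) {θ : ℝ × ℝ × ℝ} (hθ : θ ∈ upper) :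
    ‖jetEval V θ solutionJet‖ ≤ 4 * (‖V 1 θ‖ * ‖V 0 θ‖) + 2 * (‖V 0 θ‖ * ‖V 0 θ‖) ^ 2 := by
  rw [jetEval_solutionJet, norm_mul, norm_neg, RCLike.norm_ofNat]
  have h := fun m n => hV.norm_elt_le hθ m n
  have h1 := norm_add₃_le (a := elt V 1 0 θ) (b := elt V 0 1 θ) (c := elt V 0 0 θ * elt V 0 0 θ)
  rw [norm_mul] at h1
  have h2 := mul_le_mul (h 0 0) (h 0 0) (norm_nonneg _) (by positivity)
  linarith [h 1 0, h 0 1]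

theorem abs_jetRe_solutionJet_le (hV : IsFlow V ε) (x₀ : ℝ) {x : ℝ} (hx : x₀ ≤ x) (y : ℝ)
    {t : ℝ} (ht : 0 < t) :
    |jetRe V solutionJet x y t| ≤ Real.exp (-(2 * ε * (x - x₀))) *
      (4 * (‖V 1 (toKP x₀ y t)‖ * ‖V 0 (toKP x₀ y t)‖)
        + 2 * (‖V 0 (toKP x₀ y t)‖ * ‖V 0 (toKP x₀ y t)‖) ^ 2) := by
  refine (Complex.abs_re_le_norm _).trans
    ((hV.norm_jetEval_solutionJet_le (toKP_mem_upper x y ht)).trans ?_)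
  have hs : 0 ≤ x - x₀ := sub_nonneg.2 hx
  have hθ := toKP_mem_upper x₀ y ht
  have e : toKP x y t = toKP x₀ y t + (x - x₀, 0, 0) := by
    rw [← toKP_add, add_sub_cancel]
  have h0 := hV.norm_shift_le 0 _ hθ _ hs
  have h1 := hV.norm_shift_le 1 _ hθ _ hs
  rw [← e] at h0 h1
  have hE : Real.exp (-(2 * ε * (x - x₀))) =
      Real.exp (-(ε * (x - x₀))) * Real.exp (-(ε * (x - x₀))) := by
    rw [← Real.exp_add]; ring_nf
  have hE0 := (Real.exp_pos (-(ε * (x - x₀)))).le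
  have hE1 : Real.exp (-(ε * (x - x₀))) ≤ 1 :=
    Real.exp_le_one_iff.2 (neg_nonpos.2 (mul_nonneg hV.eps_pos.le hs))
  rw [hE]
  generalize Real.exp (-(ε * (x - x₀))) = E at *
  have ha := mul_le_mul h1 h0 (norm_nonneg _) (by positivity)
  have hb := mul_le_mul h0 h0 (norm_nonneg _) (by positivity)
  have hEE : E * E ≤ 1 := mul_le_one₀ hE1 hE0 hE1
  have hc := pow_le_pow_left₀ (by positivity) hb 2
  set a := ‖V 0 (toKP x₀ y t)‖
  set b := ‖V 1 (toKP x₀ y t)‖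
  have hd : (E * a * (E * a)) ^ 2 ≤ E * E * (a * a) ^ 2 := by
    have : (E * a * (E * a)) ^ 2 = (E * E) * ((E * E) * (a * a) ^ 2) := by ring
    rw [this]
    exact mul_le_mul_of_nonneg_left (mul_le_of_le_one_left (by positivity) hEE) (by positivity)
  nlinarith

theorem tendsto_jetRe_solutionJet (hV : IsFlow V ε) (y : ℝ) {t : ℝ} (ht : 0 < t) :
    Tendsto (fun x => jetRe V solutionJet x y t) atTop (𝓝 0) := by
  have h1 : Tendsto (fun x : ℝ => 2 * ε * (x - 0)) atTop atTop :=
    (tendsto_atTop_add_const_right _ _ tendsto_id).const_mul_atTop (mul_pos two_pos hV.eps_pos)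
  have h2 := (Real.tendsto_exp_neg_atTop_nhds_zero.comp h1).mul_const
    (4 * (‖V 1 (toKP 0 y t)‖ * ‖V 0 (toKP 0 y t)‖)
        + 2 * (‖V 0 (toKP 0 y t)‖ * ‖V 0 (toKP 0 y t)‖) ^ 2)
  rw [zero_mul] at h2
  refine squeeze_zero_norm' ?_ h2
  filter_upwards [eventually_ge_atTop 0] with x hx
  exact hV.abs_jetRe_solutionJet_le 0 hx y ht

theorem bounded_jetRe_solutionJet (hV : IsFlow V ε) (x₀ : ℝ) {Q : Set (ℝ × ℝ)} (hQ : IsCompact Q)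
    (hpos : ∀ w ∈ Q, 0 < w.2) :
    ∃ M : ℝ, ∀ x, x₀ ≤ x → ∀ w ∈ Q, |jetRe V solutionJet x w.1 w.2| ≤ M := by
  have hc : ∀ n, ContinuousOn (fun w : ℝ × ℝ => ‖V n (toKP x₀ w.1 w.2)‖) Q := fun n => by
    have h1 : Continuous fun w : ℝ × ℝ => toKP x₀ w.1 w.2 := by unfold toKP; fun_prop
    exact ((hV.contDiffOn n).continuousOn.comp h1.continuousOn fun w hw => hpos w hw).norm
  obtain ⟨M, hM⟩ := (hQ.image_of_continuousOn ((((hc 1).mul (hc 0)).const_mul 4).add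
    ((((hc 0).mul (hc 0)).pow 2).const_mul 2))).bddAbove
  refine ⟨M, fun x hx w hw => (hV.abs_jetRe_solutionJet_le x₀ hx w.1 (hpos w hw)).trans ?_⟩
  refine (mul_le_of_le_one_left (by positivity) (Real.exp_le_one_iff.2 ?_)).trans
    (hM (mem_image_of_mem _ hw))
  exact neg_nonpos.2 (mul_nonneg (mul_nonneg two_pos.le hV.eps_pos.le) (sub_nonneg.2 hx))

theorem marchenkoAt_marchenkoKernel (hV : IsFlow V ε) (x z y : ℝ) {t : ℝ} (ht : 0 < t) :
    MarchenkoAt (pairing V 0 0) x y t (fun z => marchenkoKernel V x z y t) z := by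
  set ψ := res V (toKP x y t) (V 0 (toKP x y t)) with hψ
  have hi := hV.integrableOn_inner_smul x y ht ψ
  have hf : (fun ξ => marchenkoKernel V x ξ y t * pairing V 0 0 ξ z y t) = fun ξ =>
      -inner ℂ (V 0 (toKP z y t)) (inner ℂ (V 0 (toKP ξ y t)) ψ • V 0 (toKP ξ y t)) := by
    funext ξ
    rw [inner_smul_right, marchenkoKernel, pairing, neg_mul]
  unfold MarchenkoAt
  rw [hf]
  refine ⟨(hi.const_inner _).neg, ?_⟩
  rw [integral_neg, integral_inner hi, ← hV.gram_toKP_apply x y ht]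
  have h1 : pairing V 0 0 x z y t = inner ℂ (V 0 (toKP z y t)) (ψ + gram V (toKP x y t) ψ) := by
    rw [hV.res_add_gram_res (toKP_mem_upper x y ht), pairing]
  have h2 : marchenkoKernel V x z y t = -inner ℂ (V 0 (toKP z y t)) ψ := rfl
  simp only [h1, h2, inner_add_right]
  ring

/-- A solution `φ` has the form `z ↦ -⟨u(z), η⟩` with `η = u(x) + ∫ φ u`; inserting this into the
integral gives `η + G η = u(x)`, which determines `η`. -/
theorem marchenko_unique (hV : IsFlow V ε) (x y : ℝ) {t : ℝ} (ht : 0 < t) {φ : ℝ → ℂ}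
    (hφ : MemLp φ 2 (volume.restrict (Ici x)))
    (h : ∀ᵐ z ∂(volume.restrict (Ici x)), MarchenkoAt (pairing V 0 0) x y t φ z) :
    φ =ᵐ[volume.restrict (Ici x)] fun z => marchenkoKernel V x z y t := by
  have hset : volume.restrict (Ici x) = volume.restrict (Ioi x) :=
    (Measure.restrict_congr_set Ioi_ae_eq_Ici).symm
  rw [hset] at hφ h ⊢
  have hθ := toKP_mem_upper x y ht
  have hi : IntegrableOn (fun ξ => φ ξ • V 0 (toKP ξ y t)) (Ioi x) :=
    memLp_one_iff_integrable.1 ((hV.memLp_toKP x y ht).smul hφ)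
  set χ := ∫ ξ in Ioi x, φ ξ • V 0 (toKP ξ y t) with hχ
  set η := V 0 (toKP x y t) + χ with hη
  have h1 : ∀ᵐ z ∂(volume.restrict (Ioi x)), φ z = -inner ℂ (V 0 (toKP z y t)) η := by
    filter_upwards [h] with z hz
    have hf : (fun ξ => φ ξ * pairing V 0 0 ξ z y t) = fun ξ =>
        inner ℂ (V 0 (toKP z y t)) (φ ξ • V 0 (toKP ξ y t)) := by
      funext ξ
      rw [inner_smul_right, pairing]
    have h2 := hz.2
    rw [hf, integral_inner hi, ← hχ] at h2
    rw [hη, inner_add_right]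
    rw [pairing] at h2
    linear_combination h2
  have h2 : χ = -gram V (toKP x y t) η := by
    rw [hV.gram_toKP_apply x y ht, hχ, ← integral_neg]
    refine integral_congr_ae ?_
    filter_upwards [h1] with ξ hξ
    rw [hξ, neg_smul]
  have h3 : η = res V (toKP x y t) (V 0 (toKP x y t)) := by
    refine sub_eq_zero.1 (hV.eq_zero_of_add_gram_eq_zero hθ ?_)
    have h4 := hV.res_add_gram_res hθ (V 0 (toKP x y t))
    have h5 : η + gram V (toKP x y t) η = V 0 (toKP x y t) := by
      nth_rewrite 1 [hη]
      rw [h2]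
      abel
    rw [map_sub, sub_add_sub_comm, h4, h5, sub_self]
  filter_upwards [h1] with z hz
  rw [hz, h3, marchenkoKernel]

end IsFlow
end Flow

/-! ### The flow in `L²(μ)` given by a spectral measure -/

/-- The remainder is written with complex scalars, so that only the complex structure of `H` enters;
for `H = L²(μ)` the two real structures would otherwise have to be identified. -/
theorem hasFDerivAt_lin3_of_remainder_le {H : Type*} [NormedAddCommGroup H] [NormedSpace ℂ H]
    {f : ℝ × ℝ × ℝ → H} {A B C : H} {θ : ℝ × ℝ × ℝ} {M : ℝ}
    (h : ∀ᶠ η : ℝ × ℝ × ℝ in 𝓝 0, ‖f (θ + η) - f θ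
      - ((η.1 : ℂ) • A + (η.2.1 : ℂ) • B + (η.2.2 : ℂ) • C)‖ ≤ M * ‖η‖ ^ 2) :
    HasFDerivAt f (lin3 A B C) θ := by
  rw [hasFDerivAt_iff_isLittleO_nhds_zero]
  have hO : (fun η : ℝ × ℝ × ℝ => f (θ + η) - f θ - lin3 A B C η) =O[𝓝 0] fun η => ‖η‖ ^ 2 := by
    refine Asymptotics.IsBigO.of_bound M ?_
    filter_upwards [h] with η hη
    rwa [norm_pow, norm_norm]
  exact hO.trans_isLittleO (Asymptotics.isLittleO_norm_pow_id one_lt_two)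

theorem norm_exp_sub_one_sub_id_le (z : ℂ) :
    ‖Complex.exp z - 1 - z‖ ≤ 3 * ‖z‖ ^ 2 * max 1 (Real.exp z.re) := by
  have hm : 1 ≤ max 1 (Real.exp z.re) := le_max_left _ _
  rcases le_total ‖z‖ 1 with h | h
  · refine (Complex.norm_exp_sub_one_sub_id_le h).trans ?_
    nlinarith [sq_nonneg ‖z‖]
  · have h1 : ‖Complex.exp z - 1 - z‖ ≤ Real.exp z.re + 1 + ‖z‖ := by
      refine (norm_sub_le _ _).trans (add_le_add ((norm_sub_le _ _).trans_eq ?_) le_rfl)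
      rw [Complex.norm_exp, norm_one]
    have h2 : Real.exp z.re ≤ max 1 (Real.exp z.re) := le_max_right _ _
    have h3 : 1 ≤ ‖z‖ ^ 2 := one_le_pow₀ h
    nlinarith [mul_le_mul h3 hm zero_le_one (by positivity)]

theorem norm_toLp_le_of_ae_le {α : Type*} [MeasurableSpace α] {μ : Measure α} {f : α → ℂ}
    {g : α → ℝ} {c : ℝ} (hf : MemLp f 2 μ) (hg : MemLp g 2 μ)
    (h : ∀ᵐ w ∂μ, ‖f w‖ ≤ c * ‖g w‖) : ‖hf.toLp‖ ≤ c * ‖hg.toLp‖ := by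
  refine Lp.norm_le_mul_norm_of_ae_le_mul ?_
  filter_upwards [h, hf.coeFn_toLp, hg.coeFn_toLp] with w h1 h2 h3
  rwa [h2, h3]

/-- The properties of the spectral measure on which the argument rests. The bound
`phase p q y ≤ C y` expresses that the support lies below the envelope. -/
structure IsSpectral (μ : Measure (ℝ × ℝ)) (C : ℝ → ℝ) (ε : ℝ) : Prop where
  eps_pos : 0 < ε
  continuous : Continuous C
  le_snd : ∀ᵐ w ∂μ, ε ≤ w.2
  phase_le : ∀ᵐ w ∂μ, ∀ y, phase w.1 w.2 y ≤ C y
  exp_moment : ∀ a : ℝ, 0 < a →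
    ∫⁻ w, ENNReal.ofReal (Real.exp (a * (w.2 + |w.1|))) ∂μ < ⊤

/-- The spectral parameter `a = i p - q`. -/
def wave (w : ℝ × ℝ) : ℂ := Complex.I * w.1 - w.2

/-- The exponent `a X + (i/4) a² Y - a³ T`. Its real part is half of that of
the exponent of the kernel at `x = z`; the imaginary part is chosen so that every derivative of the
exponential is multiplication by a polynomial in `a`. -/
def expo (w : ℝ × ℝ) (θ : ℝ × ℝ × ℝ) : ℂ :=
  wave w * θ.1 + Complex.I / 4 * wave w ^ 2 * θ.2.1 - wave w ^ 3 * θ.2.2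

/-- The function `aⁿ exp (a X + (i/4) a² Y - a³ T)` of `w = (p, q)`. -/
def mode (n : ℕ) (θ : ℝ × ℝ × ℝ) (w : ℝ × ℝ) : ℂ := wave w ^ n * Complex.exp (expo w θ)

/-- A weight that dominates `1`, `|p|` and `q`, hence also `|a|`, on the support of the measure. -/
def size (w : ℝ × ℝ) : ℝ := 1 + |w.1| + w.2

/-- The rate at which `mode n θ` may grow in the weight `size`; continuous on `upper`. -/
def growth (C : ℝ → ℝ) (θ : ℝ × ℝ × ℝ) : ℝ :=
  |θ.2.2 * C (θ.2.1 / θ.2.2) - θ.1 + θ.2.1 ^ 2 / (48 * θ.2.2)|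

open scoped Classical in
/-- The class of `mode n θ` in `L²(μ)`. It is square integrable for `T > 0`; where it is not, the
value is `0`. -/
def modeLp (μ : Measure (ℝ × ℝ)) (n : ℕ) (θ : ℝ × ℝ × ℝ) : Lp ℂ 2 μ :=
  if h : MemLp (mode n θ) 2 μ then h.toLp else 0

theorem expo_add (w : ℝ × ℝ) (θ η : ℝ × ℝ × ℝ) : expo w (θ + η) = expo w θ + expo w η := by
  simp only [expo, Prod.fst_add, Prod.snd_add, Complex.ofReal_add]
  ring

theorem wave_sq (w : ℝ × ℝ) :
    wave w ^ 2 = ((w.2 ^ 2 - w.1 ^ 2 : ℝ) : ℂ) - Complex.I * ((2 * w.1 * w.2 : ℝ) : ℂ) := by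
  unfold wave
  push_cast
  linear_combination (w.1 : ℂ) ^ 2 * Complex.I_sq

theorem wave_cube (w : ℝ × ℝ) :
    wave w ^ 3 = ((3 * w.1 ^ 2 * w.2 - w.2 ^ 3 : ℝ) : ℂ)
      + Complex.I * ((3 * w.1 * w.2 ^ 2 - w.1 ^ 3 : ℝ) : ℂ) := by
  unfold wave
  push_cast
  linear_combination ((w.1 : ℂ) ^ 3 * Complex.I - 3 * w.1 ^ 2 * w.2) * Complex.I_sq

theorem expo_eq (w : ℝ × ℝ) (θ : ℝ × ℝ × ℝ) :
    expo w θ = ((-w.2 * θ.1 + w.1 * w.2 * θ.2.1 / 2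
        + w.2 * (w.2 ^ 2 - 3 * w.1 ^ 2) * θ.2.2 : ℝ) : ℂ)
      + Complex.I * ((w.1 * θ.1 + (w.2 ^ 2 - w.1 ^ 2) * θ.2.1 / 4
        - (3 * w.1 * w.2 ^ 2 - w.1 ^ 3) * θ.2.2 : ℝ) : ℂ) := by
  rw [expo, wave_sq, wave_cube, wave]
  push_cast
  linear_combination (-(w.1 : ℂ) * w.2 * θ.2.1 / 2) * Complex.I_sq

theorem expo_re (w : ℝ × ℝ) (θ : ℝ × ℝ × ℝ) :
    (expo w θ).re = -w.2 * θ.1 + w.1 * w.2 * θ.2.1 / 2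
      + w.2 * (w.2 ^ 2 - 3 * w.1 ^ 2) * θ.2.2 := by
  rw [expo_eq, Complex.add_re, Complex.ofReal_re, Complex.I_mul_re, Complex.ofReal_im, neg_zero,
    add_zero]

/-- The kernel integrand is a product of two square integrable functions. -/
theorem kernelIntegrand_eq (x z y t : ℝ) (w : ℝ × ℝ) :
    kernelIntegrand x z y t w =
      mode 0 (toKP x y t) w * (starRingEnd ℂ) (mode 0 (toKP z y t) w) := by
  simp only [mode, pow_zero, one_mul, kernelIntegrand]
  rw [← Complex.exp_conj, ← Complex.exp_add, expo_eq, expo_eq]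
  congr 1
  simp only [map_add, map_mul, Complex.conj_I, Complex.conj_ofReal, toKP, phase]
  push_cast
  ring

theorem continuous_wave : Continuous wave := by unfold wave; fun_prop

theorem continuous_mode (n : ℕ) (θ : ℝ × ℝ × ℝ) : Continuous (mode n θ) := by
  have h := continuous_wave
  unfold mode expo
  fun_prop

theorem mode_add (n : ℕ) (θ η : ℝ × ℝ × ℝ) (w : ℝ × ℝ) :
    mode n (θ + η) w = mode n θ w * Complex.exp (expo w η) := by
  rw [mode, mode, expo_add, Complex.exp_add, mul_assoc]

theorem continuousAt_growth {C : ℝ → ℝ} (hC : Continuous C) {θ : ℝ × ℝ × ℝ} (hθ : θ ∈ upper) :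
    ContinuousAt (growth C) θ := by
  have hne : θ.2.2 ≠ 0 := ne_of_gt hθ
  have h1 : ContinuousAt (fun θ : ℝ × ℝ × ℝ => θ.2.1 / θ.2.2) θ :=
    ContinuousAt.div (by fun_prop) (by fun_prop) hne
  have h2 : ContinuousAt (fun θ : ℝ × ℝ × ℝ => θ.2.1 ^ 2 / (48 * θ.2.2)) θ :=
    ContinuousAt.div (by fun_prop) (by fun_prop) (by simpa using hne)
  have h3 : ContinuousAt (fun θ : ℝ × ℝ × ℝ => C (θ.2.1 / θ.2.2)) θ :=
    ContinuousAt.comp (f := fun θ : ℝ × ℝ × ℝ => θ.2.1 / θ.2.2) hC.continuousAt h1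
  have h4 : ContinuousAt (fun θ : ℝ × ℝ × ℝ => θ.2.2) θ := by fun_prop
  have h5 : ContinuousAt (fun θ : ℝ × ℝ × ℝ => θ.1) θ := by fun_prop
  exact (((h4.mul h3).sub h5).add h2).abs

theorem expo_re_le {C : ℝ → ℝ} {w : ℝ × ℝ} (hw : 0 ≤ w.2) (hC : ∀ y, phase w.1 w.2 y ≤ C y)
    {θ : ℝ × ℝ × ℝ} (hθ : θ ∈ upper) : (expo w θ).re ≤ growth C θ * size w := by
  have hθ' : 0 < θ.2.2 := hθ
  have h1 : (expo w θ).re = (θ.2.2 * phase w.1 w.2 (θ.2.1 / θ.2.2) - θ.1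
      + θ.2.1 ^ 2 / (48 * θ.2.2)) * w.2 := by
    rw [expo_re, phase]
    field_simp
    ring
  have h2 : θ.2.2 * phase w.1 w.2 (θ.2.1 / θ.2.2) - θ.1 + θ.2.1 ^ 2 / (48 * θ.2.2)
      ≤ growth C θ := by
    refine le_trans ?_ (le_abs_self _)
    have := mul_le_mul_of_nonneg_left (hC (θ.2.1 / θ.2.2)) hθ'.le
    linarith
  rw [h1]
  refine (mul_le_mul_of_nonneg_right h2 hw).trans
    (mul_le_mul_of_nonneg_left ?_ (abs_nonneg _))
  have := abs_nonneg w.1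
  unfold size
  linarith

theorem one_le_size {w : ℝ × ℝ} (hw : 0 ≤ w.2) : 1 ≤ size w := by
  have := abs_nonneg w.1
  unfold size
  linarith

theorem norm_wave_le {w : ℝ × ℝ} (hw : 0 ≤ w.2) : ‖wave w‖ ≤ size w := by
  refine (norm_sub_le _ _).trans ?_
  rw [norm_mul, Complex.norm_I, one_mul, Complex.norm_real, Complex.norm_real, Real.norm_eq_abs,
    Real.norm_of_nonneg hw, size]
  linarith

theorem norm_wave_pow_le {w : ℝ × ℝ} (hw : 0 ≤ w.2) (n : ℕ) :
    ‖wave w‖ ^ n ≤ Real.exp (n * size w) := by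
  rw [Real.exp_nat_mul]
  refine pow_le_pow_left₀ (norm_nonneg _) ((norm_wave_le hw).trans ?_) n
  linarith [Real.add_one_le_exp (size w)]

theorem norm_expo_le {w : ℝ × ℝ} (hw : 0 ≤ w.2) (η : ℝ × ℝ × ℝ) :
    ‖expo w η‖ ≤ 3 * Real.exp (3 * size w) * ‖η‖ := by
  have hs := one_le_size hw
  have hE : ∀ n : ℕ, n ≤ 3 → ‖wave w‖ ^ n ≤ Real.exp (3 * size w) := fun n hn =>
    (norm_wave_pow_le hw n).trans (Real.exp_le_exp.2 (mul_le_mul_of_nonneg_right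
      (by exact_mod_cast hn) (by linarith)))
  have h1 : ‖η.1‖ ≤ ‖η‖ := norm_fst_le η
  have h2 : ‖η.2‖ ≤ ‖η‖ := norm_snd_le η
  have h3 : ‖η.2.1‖ ≤ ‖η‖ := (norm_fst_le η.2).trans h2
  have h4 : ‖η.2.2‖ ≤ ‖η‖ := (norm_snd_le η.2).trans h2
  have hI : ‖Complex.I / 4‖ ≤ 1 := by norm_num
  have e1 : ‖wave w * η.1‖ ≤ Real.exp (3 * size w) * ‖η‖ := by
    rw [norm_mul, Complex.norm_real]
    exact mul_le_mul (by simpa using hE 1 (by norm_num)) h1 (norm_nonneg _) (Real.exp_pos _).le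
  have e2 : ‖Complex.I / 4 * wave w ^ 2 * η.2.1‖ ≤ Real.exp (3 * size w) * ‖η‖ := by
    rw [norm_mul, norm_mul, norm_pow, Complex.norm_real]
    exact mul_le_mul ((mul_le_of_le_one_left (by positivity) hI).trans (hE 2 (by norm_num))) h3
      (norm_nonneg _) (Real.exp_pos _).le
  have e3 : ‖wave w ^ 3 * η.2.2‖ ≤ Real.exp (3 * size w) * ‖η‖ := by
    rw [norm_mul, norm_pow, Complex.norm_real]
    exact mul_le_mul (hE 3 le_rfl) h4 (norm_nonneg _) (Real.exp_pos _).le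
  have := (norm_sub_le (wave w * η.1 + Complex.I / 4 * wave w ^ 2 * η.2.1)
    (wave w ^ 3 * η.2.2)).trans (add_le_add (norm_add_le _ _) le_rfl)
  unfold expo
  linarith

/-- The remainder of `mode n` at first order is bounded, locally uniformly in `θ`, by `‖η‖²` times a
fixed square integrable function. -/
theorem norm_mode_remainder_le {w : ℝ × ℝ} (hw : 0 ≤ w.2) {θ η : ℝ × ℝ × ℝ} {B : ℝ} (n : ℕ)
    (h1 : (expo w θ).re ≤ B * size w) (h2 : (expo w (θ + η)).re ≤ B * size w) :
    ‖mode n (θ + η) w - mode n θ w - ((η.1 : ℂ) * mode (n + 1) θ w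
      + (η.2.1 : ℂ) * (Complex.I / 4 * mode (n + 2) θ w) + (η.2.2 : ℂ) * (-mode (n + 3) θ w))‖
      ≤ 27 * ‖η‖ ^ 2 * Real.exp ((n + 6 + B) * size w) := by
  have e : mode n (θ + η) w - mode n θ w - ((η.1 : ℂ) * mode (n + 1) θ w
      + (η.2.1 : ℂ) * (Complex.I / 4 * mode (n + 2) θ w) + (η.2.2 : ℂ) * (-mode (n + 3) θ w)) =
      wave w ^ n * (Complex.exp (expo w θ) * (Complex.exp (expo w η) - 1 - expo w η)) := by
    rw [mode_add]
    simp only [mode, pow_add]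
    simp only [expo]
    ring
  rw [e, norm_mul, norm_mul, norm_pow, Complex.norm_exp]
  have h3 : Real.exp (expo w θ).re * max 1 (Real.exp (expo w η).re) ≤ Real.exp (B * size w) := by
    rw [mul_max_of_nonneg _ _ (Real.exp_pos _).le, mul_one, ← Real.exp_add]
    refine max_le (Real.exp_le_exp.2 h1) (Real.exp_le_exp.2 ?_)
    rwa [← Complex.add_re, ← expo_add]
  have h4 : ‖expo w η‖ ^ 2 ≤ 9 * Real.exp (6 * size w) * ‖η‖ ^ 2 := by
    refine (pow_le_pow_left₀ (norm_nonneg _) (norm_expo_le hw η) 2).trans_eq ?_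
    rw [mul_pow, mul_pow, ← Real.exp_nat_mul]
    ring_nf
  calc ‖wave w‖ ^ n * (Real.exp (expo w θ).re * ‖Complex.exp (expo w η) - 1 - expo w η‖)
      ≤ Real.exp (n * size w) * (Real.exp (expo w θ).re *
          (3 * ‖expo w η‖ ^ 2 * max 1 (Real.exp (expo w η).re))) := by
        gcongr
        · exact norm_wave_pow_le hw n
        · exact norm_exp_sub_one_sub_id_le _
    _ = 3 * Real.exp (n * size w) * ‖expo w η‖ ^ 2 *
          (Real.exp (expo w θ).re * max 1 (Real.exp (expo w η).re)) := by ring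
    _ ≤ 3 * Real.exp (n * size w) * (9 * Real.exp (6 * size w) * ‖η‖ ^ 2) *
          Real.exp (B * size w) := by gcongr
    _ = 27 * ‖η‖ ^ 2 * Real.exp ((n + 6 + B) * size w) := by
        rw [add_mul, add_mul, Real.exp_add, Real.exp_add]
        ring

namespace IsSpectral

variable {μ : Measure (ℝ × ℝ)} {C : ℝ → ℝ} {ε : ℝ}

theorem memLp_exp_size (hμ : IsSpectral μ C ε) {c : ℝ} (hc : 0 < c) :
    MemLp (fun w => Real.exp (c * size w)) 2 μ := by
  have hcont : Continuous fun w : ℝ × ℝ => Real.exp (c * size w) := by unfold size; fun_prop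
  rw [memLp_two_iff_integrable_sq hcont.aestronglyMeasurable]
  have h1 : Integrable (fun w : ℝ × ℝ => Real.exp (2 * c * (w.2 + |w.1|))) μ := by
    have hcont2 : Continuous fun w : ℝ × ℝ => Real.exp (2 * c * (w.2 + |w.1|)) := by fun_prop
    refine ⟨hcont2.aestronglyMeasurable, ?_⟩
    rw [hasFiniteIntegral_iff_ofReal (ae_of_all _ fun w => (Real.exp_pos _).le)]
    exact hμ.exp_moment (2 * c) (by positivity)
  refine (h1.const_mul (Real.exp (2 * c))).congr (ae_of_all _ fun w => ?_)
  dsimp only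
  rw [← Real.exp_add, ← Real.exp_nat_mul, size]
  congr 1
  push_cast
  ring

theorem memLp_mode (hμ : IsSpectral μ C ε) (n : ℕ) {θ : ℝ × ℝ × ℝ} (hθ : θ ∈ upper) :
    MemLp (mode n θ) 2 μ := by
  have hpos : 0 < (n : ℝ) + growth C θ + 1 := by
    have : 0 ≤ growth C θ := abs_nonneg _
    positivity
  refine (hμ.memLp_exp_size hpos).of_le (continuous_mode n θ).aestronglyMeasurable ?_
  filter_upwards [hμ.le_snd, hμ.phase_le] with w h1 h2
  have hw : 0 ≤ w.2 := hμ.eps_pos.le.trans h1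
  rw [mode, norm_mul, norm_pow, Complex.norm_exp, Real.norm_of_nonneg (Real.exp_pos _).le]
  refine (mul_le_mul (norm_wave_pow_le hw n) (Real.exp_le_exp.2 (expo_re_le hw h2 hθ))
    (Real.exp_pos _).le (Real.exp_pos _).le).trans ?_
  rw [← Real.exp_add, Real.exp_le_exp]
  nlinarith [one_le_size hw]

theorem modeLp_eq (hμ : IsSpectral μ C ε) (n : ℕ) {θ : ℝ × ℝ × ℝ} (hθ : θ ∈ upper) :
    modeLp μ n θ = (hμ.memLp_mode n hθ).toLp :=
  dif_pos (hμ.memLp_mode n hθ)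

theorem coeFn_modeLp (hμ : IsSpectral μ C ε) (n : ℕ) {θ : ℝ × ℝ × ℝ} (hθ : θ ∈ upper) :
    modeLp μ n θ =ᵐ[μ] mode n θ := by
  rw [hμ.modeLp_eq n hθ]
  exact MemLp.coeFn_toLp _

theorem eventually_norm_remainder_le (hμ : IsSpectral μ C ε) (n : ℕ) {θ : ℝ × ℝ × ℝ}
    (hθ : θ ∈ upper) : ∃ M : ℝ, ∀ᶠ η : ℝ × ℝ × ℝ in 𝓝 0,
    ‖modeLp μ n (θ + η) - modeLp μ n θ - ((η.1 : ℂ) • modeLp μ (n + 1) θ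
      + (η.2.1 : ℂ) • ((Complex.I / 4) • modeLp μ (n + 2) θ)
      + (η.2.2 : ℂ) • (-modeLp μ (n + 3) θ))‖ ≤ M * ‖η‖ ^ 2 := by
  have hg0 : 0 ≤ growth C θ := abs_nonneg _
  have hc : 0 < (n : ℝ) + 6 + (growth C θ + 1) := by positivity
  refine ⟨27 * ‖(hμ.memLp_exp_size hc).toLp‖, ?_⟩
  have hadd : Tendsto (fun η : ℝ × ℝ × ℝ => θ + η) (𝓝 0) (𝓝 θ) := by
    simpa using (continuous_const_add θ).tendsto (0 : ℝ × ℝ × ℝ)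
  filter_upwards [hadd.eventually (isOpen_upper.mem_nhds hθ),
    hadd.eventually ((continuousAt_growth hμ.continuous hθ).eventually_lt_const
      (lt_add_one (growth C θ)))] with η h1 h2
  rw [hμ.modeLp_eq n h1, hμ.modeLp_eq n hθ, hμ.modeLp_eq (n + 1) hθ,
    hμ.modeLp_eq (n + 2) hθ, hμ.modeLp_eq (n + 3) hθ, ← MemLp.toLp_neg,
    ← MemLp.toLp_const_smul, ← MemLp.toLp_const_smul, ← MemLp.toLp_const_smul,
    ← MemLp.toLp_const_smul, ← MemLp.toLp_add, ← MemLp.toLp_add, ← MemLp.toLp_sub,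
    ← MemLp.toLp_sub, mul_right_comm]
  refine norm_toLp_le_of_ae_le _ _ ?_
  filter_upwards [hμ.le_snd, hμ.phase_le] with w h3 h4
  have hw : 0 ≤ w.2 := hμ.eps_pos.le.trans h3
  have hs : 0 ≤ size w := zero_le_one.trans (one_le_size hw)
  rw [Real.norm_of_nonneg (Real.exp_pos _).le]
  exact norm_mode_remainder_le hw n
    ((expo_re_le hw h4 hθ).trans (mul_le_mul_of_nonneg_right (lt_add_one _).le hs))
    ((expo_re_le hw h4 h1).trans (mul_le_mul_of_nonneg_right h2.le hs))

theorem norm_modeLp_shift_le (hμ : IsSpectral μ C ε) (n : ℕ) {θ : ℝ × ℝ × ℝ} (hθ : θ ∈ upper)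
    {s : ℝ} (hs : 0 ≤ s) :
    ‖modeLp μ n (θ + (s, 0, 0))‖ ≤ Real.exp (-(ε * s)) * ‖modeLp μ n θ‖ := by
  refine Lp.norm_le_mul_norm_of_ae_le_mul ?_
  filter_upwards [hμ.le_snd, hμ.coeFn_modeLp n hθ, hμ.coeFn_modeLp n (shift_mem_upper hθ s)]
    with w h1 h2 h3
  rw [h2, h3, mode_add, norm_mul, mul_comm, Complex.norm_exp, expo_re]
  refine mul_le_mul_of_nonneg_right (Real.exp_le_exp.2 ?_) (norm_nonneg _)
  nlinarith

theorem isFlow (hμ : IsSpectral μ C ε) : IsFlow (modeLp μ) ε where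
  eps_pos := hμ.eps_pos
  hasFDerivAt n θ hθ := by
    obtain ⟨M, hM⟩ := hμ.eventually_norm_remainder_le n hθ
    exact hasFDerivAt_lin3_of_remainder_le hM
  norm_shift_le n θ hθ s hs := hμ.norm_modeLp_shift_le n hθ hs

theorem integrable_kernelIntegrand (hμ : IsSpectral μ C ε) (x z y : ℝ) {t : ℝ} (ht : 0 < t) :
    Integrable (kernelIntegrand x z y t) μ := by
  have h := (hμ.memLp_mode 0 (toKP_mem_upper x y ht)).integrable_mul
    (hμ.memLp_mode 0 (toKP_mem_upper z y ht)).star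
  exact h.congr (ae_of_all _ fun w => (kernelIntegrand_eq x z y t w).symm)

theorem kernel_eq_pairing (hμ : IsSpectral μ C ε) (x z y : ℝ) {t : ℝ} (ht : 0 < t) :
    kernel μ x z y t = pairing (modeLp μ) 0 0 x z y t := by
  rw [pairing, L2.inner_def, kernel]
  refine integral_congr_ae ?_
  filter_upwards [hμ.coeFn_modeLp 0 (toKP_mem_upper x y ht),
    hμ.coeFn_modeLp 0 (toKP_mem_upper z y ht)] with w h1 h2
  rw [h1, h2, kernelIntegrand_eq]
  rfl

end IsSpectral

/-- `C(r) + r²/48` is convex, so it lies above its tangent at `s`. -/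
theorem le_of_second_deriv {C : ℝ → ℝ} (hC : ContDiff ℝ 2 C)
    (h : ∀ s, -1 / 24 < deriv (deriv C) s) (s y : ℝ) :
    C s + deriv C s * (y - s) - (y - s) ^ 2 / 48 ≤ C y := by
  have hd : Differentiable ℝ C := hC.differentiable (by norm_num)
  have hd2 : Differentiable ℝ (deriv C) :=
    ((contDiff_succ_iff_deriv (n := 1)).1 hC).2.2.differentiable (by norm_num)
  have e1 : ∀ r, HasDerivAt (fun r => C r + r ^ 2 / 48) (deriv C r + r / 24) r := fun r =>
    ((hd r).hasDerivAt.add ((hasDerivAt_pow 2 r).div_const 48)).congr_deriv (by norm_num; ring)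
  have e2 : ∀ r, HasDerivAt (fun r => deriv C r + r / 24) (deriv (deriv C) r + 1 / 24) r :=
    fun r => (hd2 r).hasDerivAt.add ((hasDerivAt_id r).div_const 24)
  have hderiv : deriv (fun r => C r + r ^ 2 / 48) = fun r => deriv C r + r / 24 :=
    funext fun r => (e1 r).deriv
  have hconv : ConvexOn ℝ univ fun r => C r + r ^ 2 / 48 := by
    refine convexOn_univ_of_deriv2_nonneg (fun r => (e1 r).differentiableAt) ?_ fun r => ?_
    · rw [hderiv]; exact fun r => (e2 r).differentiableAt
    · rw [Function.iterate_succ_apply, Function.iterate_one, hderiv, (e2 r).deriv]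
      linarith [h r]
  rcases lt_trichotomy s y with hlt | rfl | hlt
  · have := hconv.le_slope_of_hasDerivAt (mem_univ s) (mem_univ y) hlt (e1 s)
    rw [slope_def_field, le_div_iff₀ (sub_pos.2 hlt)] at this
    nlinarith
  · simp
  · have := hconv.slope_le_of_hasDerivAt (mem_univ y) (mem_univ s) hlt (e1 s)
    rw [slope_def_field, div_le_iff₀ (sub_pos.2 hlt)] at this
    nlinarith

/-- The phase is at most its value on the envelope, at a parameter `s`, and there it equals
`C(s) + C'(s) (y - s) - (y - s)² / 48`. -/
theorem phase_le_of_mem_region {C h : ℝ → ℝ} {δ ε : ℝ} (hA : ConditionA C δ ε)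
    (hB : ConditionB C h) {w : ℝ × ℝ} (hw : w ∈ region ε h) (y : ℝ) :
    phase w.1 w.2 y ≤ C y := by
  have hpos : ∀ s, 0 < C s := fun s =>
    (pow_pos hA.eps_pos 2).trans (hA.eps_lt.trans_le (hA.le s))
  have hmem : (w.1, h w.1) ∈ envelope C := by rw [hB]; rfl
  rw [envelope_eq_range (hA.contDiff.differentiable (by norm_num)) hpos] at hmem
  obtain ⟨s, hs⟩ := hmem
  have h1 : p₀ C s = w.1 := congrArg Prod.fst hs
  have h2 : q₀ C s = h w.1 := congrArg Prod.snd hs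
  have h3 : h w.1 ^ 2 = C s + 12 * deriv C s ^ 2 := by
    rw [← h2, q₀, Real.sq_sqrt (by have := hpos s; positivity)]
  have h4 : w.2 ^ 2 ≤ h w.1 ^ 2 := pow_le_pow_left₀ (hA.eps_pos.le.trans hw.1) hw.2 2
  have h5 := le_of_second_deriv hA.contDiff hA.second_deriv s y
  rw [p₀] at h1
  rw [phase, ← h1]
  rw [h3] at h4
  nlinarith

theorem isSpectral_spectralMeasure {C h g : ℝ → ℝ} {gt : ℝ × ℝ → ℝ} {δ ε A : ℝ}
    (hA : ConditionA C δ ε) (hB : ConditionB C h) (hC : ConditionC C g A (region ε h) gt) :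
    IsSpectral (spectralMeasure (region ε h) gt) C ε := by
  have hcont : Continuous C := hA.contDiff.continuous
  -- `h` need not be known to be measurable: the region lies in the following closed set.
  have hmeas : MeasurableSet {w : ℝ × ℝ | ε ≤ w.2 ∧ ∀ y, phase w.1 w.2 y ≤ C y} := by
    refine IsClosed.measurableSet ?_
    refine (isClosed_le continuous_const continuous_snd).inter ?_
    have hi : {w : ℝ × ℝ | ∀ y, phase w.1 w.2 y ≤ C y} = ⋂ y, {w | phase w.1 w.2 y ≤ C y} := by
      ext; simp
    change IsClosed {w : ℝ × ℝ | ∀ y, phase w.1 w.2 y ≤ C y}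
    rw [hi]
    refine isClosed_iInter fun y => isClosed_le ?_ continuous_const
    unfold phase
    fun_prop
  have hae : ∀ᵐ w ∂(spectralMeasure (region ε h) gt),
      ε ≤ w.2 ∧ ∀ y, phase w.1 w.2 y ≤ C y := by
    refine (withDensity_absolutelyContinuous _ _).ae_le ?_
    refine (ae_restrict_iff hmeas).2 (ae_of_all _ fun w hw => ?_)
    exact ⟨hw.1, phase_le_of_mem_region hA hB hw⟩
  exact ⟨hA.eps_pos, hcont, hae.mono fun w hw => hw.1, hae.mono fun w hw => hw.2, hC.exp_moment⟩

/-! ### The solution of JE-I -/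

/-- Only the values of `F` for `t > 0` enter the linear system. -/
theorem SolvesLinearSystem.congr {α : ℂ} {F F' : ℝ → ℝ → ℝ → ℝ → ℂ}
    (hF : SolvesLinearSystem α F) (h : ∀ x z y t, 0 < t → F' x z y t = F x z y t) :
    SolvesLinearSystem α F' := by
  intro x z y t ht
  have h1 : (fun x' => F' x' z y t) = fun x' => F x' z y t := funext fun x' => h x' z y t ht
  have h2 : (fun z' => F' x z' y t) = fun z' => F x z' y t := funext fun z' => h x z' y t ht
  have h3 : (fun y' => F' x z y' t) = fun y' => F x z y' t := funext fun y' => h x z y' t ht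
  have h4 : deriv (fun t' => F' x z y t') t = deriv (fun t' => F x z y t') t := by
    refine Filter.EventuallyEq.deriv_eq ?_
    filter_upwards [lt_mem_nhds ht] with t' ht' using h x z y t' ht'
  rw [h1, h2, h3, h4]
  exact hF x z y t ht

theorem MarchenkoAt.congr {F F' : ℝ → ℝ → ℝ → ℝ → ℂ} {x y t z : ℝ} {φ : ℝ → ℂ}
    (hF : MarchenkoAt F x y t φ z) (h : ∀ x z, F' x z y t = F x z y t) :
    MarchenkoAt F' x y t φ z := by
  simpa only [MarchenkoAt, h] using hF

end

end Johnson

theorem lemma2 (C h g : ℝ → ℝ) (gt : ℝ × ℝ → ℝ) (δ ε A : ℝ)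
    (hA : Johnson.ConditionA C δ ε)
    (hB : Johnson.ConditionB C h)
    (hC : Johnson.ConditionC C g A (Johnson.region ε h) gt)
    (μ : Measure (ℝ × ℝ)) (hμ : μ = Johnson.spectralMeasure (Johnson.region ε h) gt)
    (F : ℝ → ℝ → ℝ → ℝ → ℂ) (hF : F = Johnson.kernel μ) :
    -- the kernel is well defined and smooth for `t > 0`, and solves the linear system for `α = i`
    (∀ x z y t : ℝ, 0 < t → Integrable (Johnson.kernelIntegrand x z y t) μ) ∧
    ContDiffOn ℝ ∞ (fun w : ℝ × ℝ × ℝ × ℝ => F w.1 w.2.1 w.2.2.1 w.2.2.2) {w | 0 < w.2.2.2} ∧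
    Johnson.SolvesLinearSystem Complex.I F ∧
    ∃ (K : ℝ → ℝ → ℝ → ℝ → ℂ) (v : ℝ → ℝ → ℝ → ℝ),
      -- `K(x, ·, y, t)` is the unique solution in `L²[x, ∞)` of the Marchenko equation
      (∀ x y t : ℝ, 0 < t →
        MemLp (fun z => K x z y t) 2 (volume.restrict (Ici x)) ∧
        (∀ z, x ≤ z → Johnson.MarchenkoAt F x y t (fun z' => K x z' y t) z) ∧
        (∀ φ : ℝ → ℂ, MemLp φ 2 (volume.restrict (Ici x)) →
          (∀ᵐ z ∂(volume.restrict (Ici x)), Johnson.MarchenkoAt F x y t φ z) →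
          φ =ᵐ[volume.restrict (Ici x)] fun z => K x z y t)) ∧
      -- `v = 2 ∂ₓ K(x, x, y, t)`
      (∀ x y t : ℝ, 0 < t → HasDerivAt (fun x' => 2 * K x' x' y t) ((v x y t : ℝ) : ℂ) x) ∧
      -- `v` is a smooth real solution of JE-I
      ContDiffOn ℝ ∞ (fun w : ℝ × ℝ × ℝ => v w.1 w.2.1 w.2.2) {w | 0 < w.2.2} ∧
      Johnson.SolvesJohnson (-1) v ∧
      -- `v` vanishes as `x → +∞`
      (∀ y t : ℝ, 0 < t → Tendsto (fun x => v x y t) atTop (𝓝 0)) ∧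
      -- `v` is bounded on right half-lines in `x`, locally uniformly in `(y, t)`, `t > 0`
      (∀ (x₀ : ℝ) (Q : Set (ℝ × ℝ)), IsCompact Q → (∀ w ∈ Q, 0 < w.2) →
        ∃ M : ℝ, ∀ x, x₀ ≤ x → ∀ w ∈ Q, |v x w.1 w.2| ≤ M) := by

  have hsp : Johnson.IsSpectral μ C ε := by
    rw [hμ]
    exact Johnson.isSpectral_spectralMeasure hA hB hC
  have hV := hsp.isFlow
  have hFp : ∀ x z y t, 0 < t → F x z y t = Johnson.pairing (Johnson.modeLp μ) 0 0 x z y t := by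
    intro x z y t ht
    rw [hF]
    exact hsp.kernel_eq_pairing x z y ht
  refine ⟨fun x z y t ht => hsp.integrable_kernelIntegrand x z y ht,
    (hV.contDiffOn_pairing 0 0).congr fun w hw => hFp _ _ _ _ hw,
    hV.solvesLinearSystem.congr hFp,
    Johnson.marchenkoKernel (Johnson.modeLp μ),
    Johnson.jetRe (Johnson.modeLp μ) Johnson.solutionJet,
    fun x y t ht => ⟨hV.memLp_marchenkoKernel x y ht,
      fun z _ => (hV.marchenkoAt_marchenkoKernel x z y ht).congr fun x z => hFp x z y t ht,
      fun φ hφ h => hV.marchenko_unique x y ht hφ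
        (h.mono fun z hz => hz.congr fun x z => (hFp x z y t ht).symm)⟩,
    fun x y t ht => ?_, hV.contDiffOn_jetRe _, hV.solvesJohnson,
    fun y t ht => hV.tendsto_jetRe_solutionJet y ht,
    fun x₀ Q hQ hpos => hV.bounded_jetRe_solutionJet x₀ hQ hpos⟩
  rw [hV.coe_jetRe_solutionJet x y ht]
  exact hV.hasDerivAt_marchenkoKernel_diag x y ht
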